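/- Let $p$ be a prime, $q=p^s$, $r=q^m$, and let $\alpha$ be a generator of $\mathrm{GF}(r)^*$. Let $h$ be an integer with $4\mid h\mid q-1$ (so $q$ is odd) and suppose $\gcd\left(m,\frac{4(q-1)}{h}\right)=2$. Put $$g=\alpha^{(q-1)/h},\qquad \beta=\alpha^{(r-1)/4},\qquad n=\frac{h(r-1)}{q-1},$$ and let $\mathcal C=\mathcal C_{(q,m,h,4)}$ be the cyclic code over $\mathrm{GF}(q)$ consisting of the words $$\mathbf c_{(a,b)}=\left(\mathrm{Tr}\left(ag^i+b(\beta g)^i\right)\right)_{i=0}^{n-1},\qquad a,b\in\mathrm{GF}(r),$$ where $\mathrm{Tr}$ is the trace from $\mathrm{GF}(r)$ to $\mathrm{GF}(q)$. Let $\psi(x)=\exp\left(\frac{2\pi i}{p}\mathrm{Tr}_p(x)\right)$, with $\mathrm{Tr}_p$ the trace from $\mathrm{GF}(r)$ to $\mathrm{GF}(p)$, and for $u\in\mathrm{GF}(r)$ let $\eta_u=\sum_{z}\psi(zu)$, where $z$ runs over the nonzero squares of $\mathrm{GF}(r)$. Put $$\lambda(a,b)=\frac{h}{2q}\sum_{i=1}^{4}\eta_{(a+\beta^i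 b)g^i}.$$ If $p\equiv1\pmod 4$ let $\pi$ be any Gaussian integer of norm $p$ with $\pi\equiv1\pmod{2+2i}$; if $p\equiv3\pmod 4$ let $\pi=i\sqrt p$. Put $T=\pi^{ms}+\bar\pi^{ms}$. Then $\pi,\bar\pi$ are the Frobenius eigenvalues of the elliptic curve $E:y^2=x^3+4x$ over $\mathrm{GF}(p)$, that is, $\pi\bar\pi=p$ and $\#E(\mathrm{GF}(p))=p+1-\pi-\bar\pi$. For all $a,b\in\mathrm{GF}(r)$ the Hamming weight of $\mathbf c_{(a,b)}$ is $$w(\mathbf c_{(a,b)})=n-\frac{h(r-1)}{q(q-1)}-\lambda(a,b).$$ Moreover, the values of $\lambda$ and the numbers of pairs $(a,b)$ attaining them are as follows. (1) On the pairs with $\prod_{i=1}^4(a+\beta^ib)\neq0$, the possible values of $\lambda(a,b)$ are the following five, with the following frequencies. * $\frac{2h\eta_1}{q}$ and $\frac{2h\eta_\alpha}{q}$: each $\frac{(r-1)(r-15-T)}{16}$ if $g(\beta+1)$ is a square in $\mathrm{GF}(r)$, and each $\frac{(r-1)(r+1-T)}{16}$ otherwise; * $\frac{2h(3\eta_1+\eta_\alpha)}{4q}$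 and $\frac{2h(\eta_1+3\eta_\alpha)}{4q}$: each $\frac{(r-1)(r-3+T)}{4}$, in both cases; * $-\frac hq$: $\frac{3(r-1)(r+1-T)}{8}$ if $g(\beta+1)$ is a square, and $\frac{(r-1)(3r-13-3T)}{8}$ otherwise. (2) On the pairs $(a,b)\ne(0,0)$ with $a+\beta^tb=0$ for some $1\le t\le4$, the possible values of $\lambda(a,b)$ are the following two, each with frequency $2(r-1)$. * If $g(\beta+1)$ is a square: $\frac h{2q}\left(\frac{r-1}2+3\eta_1\right)$ and $\frac h{2q}\left(\frac{r-1}2+3\eta_\alpha\right)$; * if $g(\beta+1)$ is not a square: $\frac h{2q}\left(\frac{r-3}2+\eta_1\right)$ and $\frac h{2q}\left(\frac{r-3}2+\eta_\alpha\right)$. The weight distribution of $\mathcal C$ is given by these rows together with the zero codeword: for every integer $w\ge0$, the number of codewords of $\mathcal C$ of weight $w$ is the sum of the frequencies of all rows of (1) and (2) (in the case at hand) whose value $\lambda$ satisfies $n-\frac{h(r-1)}{q(q-1)}-\lambda=w$, increased by $1$ if $w=0$. Finally, if $(q,m)\neq(5,2)$, then exactly eight different weights occur in $\mathcal C$, namely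 the weight $0$ and seven nonzero weights. -/

import Mathlib

namespace TwoZeroCode

section Code

/-- The length `n = h (r - 1) / (q - 1)` of the code, where `q = #F` and `r = #K`. -/
def codeLength (F K : Type*) [Fintype F] [Fintype K] (h : ℕ) : ℕ :=
  h * (Fintype.card K - 1) / (Fintype.card F - 1)

/-- The element `g = α ^ ((q - 1) / h)`. -/
def gElt (F : Type*) {K : Type*} [Fintype F] [Field K] (α : Kˣ) (h : ℕ) : K :=
  (α : K) ^ ((Fintype.card F - 1) / h)

/-- The element `β = α ^ ((r - 1) / e)`. -/
def betaElt {K : Type*} [Field K] [Fintype K] (α : Kˣ) (e : ℕ) : K :=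
  (α : K) ^ ((Fintype.card K - 1) / e)

/-- The codeword `c_(a,b) = (Tr (a g^i + b (β g)^i))_{0 ≤ i < n}`. -/
noncomputable def codeword (F : Type*) {K : Type*} [Field F] [Fintype F] [Field K] [Fintype K]
    [Algebra F K] (α : Kˣ) (h e : ℕ) (a b : K) : Fin (codeLength F K h) → F :=
  fun i => Algebra.trace F K
    (a * gElt F α h ^ (i : ℕ) + b * (betaElt α e * gElt F α h) ^ (i : ℕ))

/-- The code `C_(q,m,h,e)`: the set of all codewords `c_(a,b)`. -/
def code (F : Type*) {K : Type*} [Field F] [Fintype F] [Field K] [Fintype K]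
    [Algebra F K] (α : Kˣ) (h e : ℕ) : Set (Fin (codeLength F K h) → F) :=
  {c | ∃ a b : K, c = codeword F α h e a b}

/-- `A_w`, the number of codewords of Hamming weight `w`. -/
noncomputable def weightCount (F : Type*) {K : Type*} [Field F] [Fintype F] [DecidableEq F]
    [Field K] [Fintype K] [Algebra F K] (α : Kˣ) (h e w : ℕ) : ℕ :=
  {c ∈ code F α h e | hammingNorm c = w}.ncard

end Code

section Periods

/-- The canonical additive character `ψ x = exp (2 π i Tr_p x / p)` of a finite field `K` of
characteristic `p`. -/
noncomputable def canonicalChar (p : ℕ) [Fact p.Prime] {K : Type*} [Field K]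
    [Algebra (ZMod p) K] (x : K) : ℂ :=
  ZMod.stdAddChar (Algebra.trace (ZMod p) K x)

open Classical in
/-- `η_u^(N,r)`, the sum of `ψ (z u)` over all `z` in the subgroup generated by `α ^ N`. -/
noncomputable def gaussPeriod (p : ℕ) [Fact p.Prime] {K : Type*} [Field K] [Fintype K]
    [Algebra (ZMod p) K] (α : Kˣ) (N : ℕ) (u : K) : ℂ :=
  ∑ z : Kˣ with z ∈ Subgroup.zpowers (α ^ N), canonicalChar p ((z : K) * u)

/-- The modified weight
`λ(a,b) = (h N / (e q)) ∑_{i=1}^{e} η_{(a + β^i b) g^i}^(N,r)`. -/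
noncomputable def modifiedWeight (p : ℕ) [Fact p.Prime] (F : Type*) {K : Type*} [Field F]
    [Fintype F] [Field K] [Fintype K] [Algebra (ZMod p) K] (α : Kˣ) (h e N : ℕ) (a b : K) : ℂ :=
  (h : ℂ) * N / (e * (Fintype.card F : ℂ)) *
    ∑ i ∈ Finset.Icc 1 e,
      gaussPeriod p α N ((a + betaElt α e ^ i * b) * gElt F α h ^ i)

/-- The pairs `(a,b)` with `∏_{i=1}^{e} (a + β^i b) ≠ 0`. -/
def genericPairs {K : Type*} [Field K] [Fintype K] (α : Kˣ) (e : ℕ) : Set (K × K) :=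
  {ab | ∏ i ∈ Finset.Icc 1 e, (ab.1 + betaElt α e ^ i * ab.2) ≠ 0}

/-- The pairs `(a,b) ≠ (0,0)` with `a + β^t b = 0` for some `1 ≤ t ≤ e`. -/
def degeneratePairs {K : Type*} [Field K] [Fintype K] (α : Kˣ) (e : ℕ) : Set (K × K) :=
  {ab | ab ≠ (0, 0) ∧ ∃ t ∈ Finset.Icc 1 e, ab.1 + betaElt α e ^ t * ab.2 = 0}

end Periods

section Tables

/-- The number `π`: if `p ≡ 1 (mod 4)`, a Gaussian integer of norm `p` congruent to `1` modulo
`2 + 2i`; if `p ≡ 3 (mod 4)`, the number `i √p`. -/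
def IsFrobeniusPi (p : ℕ) (ϖ : ℂ) : Prop :=
  (p % 4 = 1 → ∃ z : GaussianInt,
    z.norm = (p : ℤ) ∧ (⟨2, 2⟩ : GaussianInt) ∣ z - 1 ∧ ϖ = GaussianInt.toComplex z) ∧
  (p % 4 = 3 → ϖ = Complex.I * (Real.sqrt p : ℂ))

/-- The elliptic curve `y² = x³ + 4x` over `GF(p)`. -/
def curveE (p : ℕ) : WeierstrassCurve.Affine (ZMod p) := ⟨0, 0, 0, 4, 0⟩

/- Each table below is a list of rows `(value of λ, frequency)`; `A` and `B` stand for the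
Gaussian periods `η_1` and `η_α`, and `T` for `π^(ms) + conj(π)^(ms)`. -/

/-- Generic pairs, `g (β + 1)` a square. -/
noncomputable def table1 (q r h : ℕ) (A B T : ℂ) : Fin 5 → ℂ × ℂ :=
  ![(2 * h * A / q, (r - 1) * (r - 15 - T) / 16),
    (2 * h * B / q, (r - 1) * (r - 15 - T) / 16),
    (2 * h * (3 * A + B) / (4 * q), (r - 1) * (r - 3 + T) / 4),
    (2 * h * (A + 3 * B) / (4 * q), (r - 1) * (r - 3 + T) / 4),
    (-h / q, 3 * (r - 1) * (r + 1 - T) / 8)]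

/-- Generic pairs, `g (β + 1)` not a square. -/
noncomputable def table2 (q r h : ℕ) (A B T : ℂ) : Fin 5 → ℂ × ℂ :=
  ![(2 * h * A / q, (r - 1) * (r + 1 - T) / 16),
    (2 * h * B / q, (r - 1) * (r + 1 - T) / 16),
    (2 * h * (3 * A + B) / (4 * q), (r - 1) * (r - 3 + T) / 4),
    (2 * h * (A + 3 * B) / (4 * q), (r - 1) * (r - 3 + T) / 4),
    (-h / q, (r - 1) * (3 * r - 13 - 3 * T) / 8)]

/-- Degenerate pairs, `g (β + 1)` a square. -/
noncomputable def table3 (q r h : ℕ) (A B : ℂ) : Fin 2 → ℂ × ℂ :=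
  ![(h / (2 * q) * ((r - 1) / 2 + 3 * A), 2 * (r - 1)),
    (h / (2 * q) * ((r - 1) / 2 + 3 * B), 2 * (r - 1))]

/-- Degenerate pairs, `g (β + 1)` not a square. -/
noncomputable def table4 (q r h : ℕ) (A B : ℂ) : Fin 2 → ℂ × ℂ :=
  ![(h / (2 * q) * ((r - 3) / 2 + A), 2 * (r - 1)),
    (h / (2 * q) * ((r - 3) / 2 + B), 2 * (r - 1))]

/-- On the set `S` of pairs, the function `lam` takes only the values listed in `table`, each with
the listed frequency. -/
def IsDistribution {K ι : Type*} (S : Set (K × K)) (lam : K → K → ℂ) (table : ι → ℂ × ℂ) :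
    Prop :=
  (∀ ab ∈ S, ∃ j, lam ab.1 ab.2 = (table j).1) ∧
  ∀ j, (({ab ∈ S | lam ab.1 ab.2 = (table j).1}.ncard : ℕ) : ℂ) = (table j).2

open Classical in
/-- The sum of the frequencies of those rows of `table` whose value `λ` gives the Hamming weight
`w = n - h (r - 1) / (q (q - 1)) - λ`. -/
noncomputable def tableCount {ι : Type*} [Fintype ι] (n q r h : ℕ) (table : ι → ℂ × ℂ) (w : ℕ) :
    ℂ :=
  ∑ j with (w : ℂ) = n - h * (r - 1) / (q * (q - 1)) - (table j).1, (table j).2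

end Tables

end TwoZeroCode

/-! Write `q = #F`, `r = #K`, `χ` for the quadratic character of `K`, `G` for its Gauss sum, and
`x_i = (a + β^i b) g^i`, so that the `i`-th coordinate of the codeword is `Tr x_i`.

Weights. Orthogonality of characters of `F` turns the number of zero coordinates into a sum of `ψ(y
x_i)` over `i` and over `y` in `F`. Since `β^4 = 1`, `x_(4j+k) = g^(4j) x_k`. The gcd condition
makes multiplication `⟨g^4⟩ × F^* → K^*` a homomorphism onto the nonzero squares, so the sum
collapses to `h/2` times four periods (`Admissible.sum_sum_units`,
`Admissible.hammingNorm_codeword`).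

Values. For `u ≠ 0`, `2 η_u = -1 + χ(u) G`, and `2 η_0 = r - 1`. Hence `λ = h (c + v G) / (4q)`,
where `v` is the sum of the four signs `χ(x_t)`, and `c` is `-4` off the four lines `a + β^t b = 0`,
`r - 4` at a nonzero point of a line and `4(r - 1)` at the origin. Every element of `F` is a square
in `K` because `m` is even; so `χ(β + 1) = 1`, and the case distinction on `g(β + 1)` is one on
`χ(g)`.

Frequencies. The indicator of a given `v` is a polynomial in the four signs. Its odd part sums to
zero, as scaling `(a,b)` by a nonsquare shows; its quadratic part is elementary; its quartic part is
the sum of `χ(a^4 - b^4)`, that is, essentially `∑ χ(a^4 - 1)`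
(`IsFourthRoot.card_offLine_signSum`).

The last sum is expressed by a Jacobi sum `J(ρ², ρ)` with `ρ` quartic, a Gaussian integer of norm
`r` with `-J ≡ 1` modulo `2 + 2i`. Unique factorization identifies `-J` with `π^(ms)` or its
conjugate, once `p ∤ J` is known for `p ≡ 1 (mod 4)`, which follows from Lucas' theorem
(`sum_quadraticChar_eq_frobenius`).

Eight weights. As `G² = r`, two equal values of `λ` with different `c` force `(v - v')² = k² r` with
`k` in `{1, 3, 4}`, impossible when `r` is large. The case `k = 3, 4` never occurs, so only `(0,0)`
gives the zero word and codewords can be counted by pairs. -/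

namespace GaussianInt

/-! ### Gaussian integers of prime power norm -/

theorem eq_one_of_isUnit_of_two_add_two_mul_I_dvd_sub_one {u : GaussianInt} (hu : IsUnit u)
    (h : (⟨2, 2⟩ : GaussianInt) ∣ u - 1) : u = 1 := by
  obtain ⟨c, hc⟩ := h
  have hn : u.re * u.re + u.im * u.im = 1 := by
    have := (Zsqrtd.norm_eq_one_iff' (by norm_num) u).2 hu
    rw [Zsqrtd.norm_def] at this
    linarith
  have h1 := congrArg Zsqrtd.re hc
  have h2 := congrArg Zsqrtd.im hc
  simp only [Zsqrtd.re_sub, Zsqrtd.im_sub, Zsqrtd.re_mul, Zsqrtd.im_mul, Zsqrtd.re_one,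
    Zsqrtd.im_one] at h1 h2
  have b1 : u.re ≤ 1 := by nlinarith
  have b2 : -1 ≤ u.re := by nlinarith
  have b3 : u.im ≤ 1 := by nlinarith
  have b4 : -1 ≤ u.im := by nlinarith
  apply Zsqrtd.ext
  · rw [Zsqrtd.re_one]
    have : u.re = -1 ∨ u.re = 0 ∨ u.re = 1 := by omega
    rcases this with h | h | h <;> rw [h] at hn h1
    · have : u.im = 0 := by nlinarith
      omega
    · omega
    · rw [h]
  · rw [Zsqrtd.im_one]
    omega

theorem two_add_two_mul_I_dvd_pow_sub_one {z : GaussianInt} (h : (⟨2, 2⟩ : GaussianInt) ∣ z - 1)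
    (k : ℕ) : (⟨2, 2⟩ : GaussianInt) ∣ z ^ k - 1 := by
  have := sub_dvd_pow_sub_pow z 1 k
  rw [one_pow] at this
  exact h.trans this

/-- Distinct units are incongruent modulo `2 + 2i`, so an associate class has at most one member
congruent to 1. This fixes the unit when a Jacobi sum is compared with a power of `π`. -/
theorem eq_one_of_two_add_two_mul_I_dvd {u w z : GaussianInt} (hu : IsUnit u) (hz : z = u * w)
    (h1 : (⟨2, 2⟩ : GaussianInt) ∣ w - 1) (h2 : (⟨2, 2⟩ : GaussianInt) ∣ z - 1) : z = w := by
  have : (⟨2, 2⟩ : GaussianInt) ∣ u - 1 := by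
    have h3 : u - 1 = (z - 1) - u * (w - 1) := by rw [hz]; ring
    rw [h3]
    exact dvd_sub h2 (h1.mul_left _)
  rw [hz, eq_one_of_isUnit_of_two_add_two_mul_I_dvd_sub_one hu this, one_mul]

theorem two_add_two_mul_I_dvd_star_sub_one {z : GaussianInt}
    (h : (⟨2, 2⟩ : GaussianInt) ∣ z - 1) : (⟨2, 2⟩ : GaussianInt) ∣ star z - 1 := by
  obtain ⟨c, hc⟩ := h
  refine ⟨⟨0, -1⟩ * star c, ?_⟩
  have : star (z - 1) = star z - 1 := by rw [star_sub, star_one]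
  rw [← this, hc, star_mul]
  ext <;> simp <;> ring

theorem prime_of_norm_eq {p : ℕ} (hp : p.Prime) {w : GaussianInt} (hw : w.norm = p) :
    Prime w := by
  rw [← irreducible_iff_prime]
  constructor
  · intro h
    have := (Zsqrtd.norm_eq_one_iff' (by norm_num) w).2 h
    rw [hw] at this
    exact hp.one_lt.ne' (by exact_mod_cast this)
  · intro a b hab
    have h := congrArg (fun x => (Zsqrtd.norm x).natAbs) hab
    simp only [hw, Zsqrtd.norm_mul, Int.natAbs_mul, Int.natAbs_natCast] at h
    rw [← Zsqrtd.norm_eq_one_iff, ← Zsqrtd.norm_eq_one_iff]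
    rcases hp.eq_one_or_self_of_dvd _ ⟨_, h⟩ with h' | h'
    · exact Or.inl h'
    · right
      rw [h'] at h
      exact Nat.eq_of_mul_eq_mul_left hp.pos (by linarith)

theorem mul_star_eq_norm (z : GaussianInt) : z * star z = (z.norm : GaussianInt) :=
  (Zsqrtd.norm_eq_mul_conj z).symm

/-- The primes above `p` are `w` and `star w`; if both divided `z`, so would their product `p`.
Hence only one of them occurs. -/
theorem eq_unit_mul_pow_of_norm {p : ℕ} (hp : p.Prime) {w : GaussianInt} (hw : w.norm = p) :
    ∀ (k : ℕ) {z : GaussianInt}, z.norm = (p : ℤ) ^ k → ¬ (p : GaussianInt) ∣ z →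
      ∃ u, IsUnit u ∧ (z = u * w ^ k ∨ star z = u * w ^ k) := by
  have hww : w * star w = p := by rw [mul_star_eq_norm, hw]; simp
  have key : ∀ (k : ℕ), (∀ {z : GaussianInt}, z.norm = (p : ℤ) ^ k → ¬ (p : GaussianInt) ∣ z →
      ∃ u, IsUnit u ∧ (z = u * w ^ k ∨ star z = u * w ^ k)) → ∀ z : GaussianInt,
      (w * z).norm = (p : ℤ) ^ (k + 1) → ¬ (p : GaussianInt) ∣ w * z →
      ∃ u, IsUnit u ∧ (w * z = u * w ^ (k + 1) ∨ star (w * z) = u * w ^ (k + 1)) := by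
    intro k ih z hz hpz
    rw [Zsqrtd.norm_mul, hw, pow_succ'] at hz
    have hz' : z.norm = (p : ℤ) ^ k :=
      mul_left_cancel₀ (by exact_mod_cast hp.ne_zero) hz
    obtain ⟨u, hu, h | h⟩ := ih hz' (fun h => hpz (h.mul_left _))
    · exact ⟨u, hu, Or.inl (by rw [h]; ring)⟩
    -- The cofactor may be a power of `star w` only for exponent 0, where it is a unit; otherwise `w
    -- * star w = p` divides `w * z`.
    · rcases k with _ | k
      · refine ⟨z, ?_, Or.inl (by ring)⟩
        rw [pow_zero, mul_one] at h
        rw [← h] at hu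
        simpa using hu.star
      · exfalso
        apply hpz
        have : z = star u * star w ^ (k + 1) := by
          rw [← star_star z, h, star_mul, star_pow, mul_comm]
        rw [this, pow_succ, ← hww]
        exact ⟨star u * star w ^ k, by ring⟩
  intro k
  induction k with
  | zero =>
    intro z hz _
    exact ⟨z, (Zsqrtd.norm_eq_one_iff' (by norm_num) z).1 (by simpa using hz), Or.inl (by simp)⟩
  | succ k ih =>
    intro z hz hpz
    have h1 : w ∣ z * star z := by
      rw [mul_star_eq_norm, hz]
      refine (Dvd.intro _ hww).trans ?_
      rw [pow_succ']
      push_cast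
      exact dvd_mul_right _ _
    rcases (prime_of_norm_eq hp hw).dvd_or_dvd h1 with ⟨z', h'⟩ | ⟨z', h'⟩
    · subst h'
      exact key k ih z' hz hpz
    · have h2 : ¬ (p : GaussianInt) ∣ star z := by
        rintro ⟨c, hc⟩
        apply hpz
        refine ⟨star c, ?_⟩
        rw [← star_star z, hc, star_mul, star_natCast, mul_comm]
      rw [h'] at h2
      have h3 : (w * z').norm = (p : ℤ) ^ (k + 1) := by
        rw [← h', ← hz]
        exact Zsqrtd.norm_conj z
      obtain ⟨u, hu, h⟩ := key k ih z' h3 h2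
      rw [← h', star_star] at h
      exact ⟨u, hu, h.symm⟩

/-- An inert `p` divides `z` as soon as it divides `z * star z`, so factors `p` can be split off one
at a time. -/
theorem eq_unit_mul_prime_pow {p : ℕ} (hp : Prime (p : GaussianInt)) :
    ∀ (l : ℕ) {z : GaussianInt}, z.norm = (p : ℤ) ^ (2 * l) →
      ∃ u, IsUnit u ∧ z = u * (p : GaussianInt) ^ l := by
  intro l
  induction l with
  | zero =>
    intro z hz
    exact ⟨z, (Zsqrtd.norm_eq_one_iff' (by norm_num) z).1 (by simpa using hz), by simp⟩
  | succ l ih =>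
    intro z hz
    have h1 : (p : GaussianInt) ∣ z * star z := by
      rw [mul_star_eq_norm, hz, mul_add, mul_one, pow_succ]
      push_cast
      exact dvd_mul_left _ _
    have h2 : (p : GaussianInt) ∣ z := by
      rcases hp.dvd_or_dvd h1 with h | ⟨c, hc⟩
      · exact h
      · refine ⟨star c, ?_⟩
        rw [← star_star z, hc, star_mul, star_natCast, mul_comm]
    obtain ⟨z', rfl⟩ := h2
    have hp0 : (p : ℤ) ≠ 0 := by
      have := hp.ne_zero
      exact_mod_cast this
    have h3 : z'.norm = (p : ℤ) ^ (2 * l) := by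
      rw [Zsqrtd.norm_mul, Zsqrtd.norm_natCast] at hz
      apply mul_left_cancel₀ (mul_ne_zero hp0 hp0)
      rw [hz]
      ring
    obtain ⟨u, hu, h⟩ := ih h3
    exact ⟨u, hu, by rw [h]; ring⟩

theorem toComplex_add_conj (z : GaussianInt) : (z : ℂ) + starRingEnd ℂ (z : ℂ) = 2 * (z.re : ℂ) := by
  rw [toComplex_def]
  simp only [map_add, map_mul, Complex.conj_I, map_intCast]
  ring

end GaussianInt

namespace TwoZeroCode

/-- If `p ≡ 1 (mod 4)`, then `z` is `π^k` or its conjugate, and the trace does not see which. If `p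
≡ 3 (mod 4)`, then `k = 2l` and `z = (-p)^l = π^(2l)`. -/
theorem two_mul_re_eq_of_isFrobeniusPi {p : ℕ} [hp : Fact p.Prime] (hp2 : p ≠ 2) {ϖ : ℂ}
    (hϖ : IsFrobeniusPi p ϖ) {k : ℕ} {z : GaussianInt} (hz : z.norm = (p : ℤ) ^ k)
    (h1 : (⟨2, 2⟩ : GaussianInt) ∣ z - 1) (hz1 : p % 4 = 1 → ¬ (p : GaussianInt) ∣ z)
    (hz3 : p % 4 = 3 → Even k) :
    (2 * (z.re : ℂ)) = ϖ ^ k + (starRingEnd ℂ ϖ) ^ k := by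
  have hodd : p % 4 = 1 ∨ p % 4 = 3 := by
    have := hp.out.eq_two_or_odd
    omega
  rw [← GaussianInt.toComplex_add_conj]
  rcases hodd with h4 | h4
  · obtain ⟨w, hw, hw1, rfl⟩ := hϖ.1 h4
    obtain ⟨u, hu, h | h⟩ := GaussianInt.eq_unit_mul_pow_of_norm hp.out hw k hz (hz1 h4)
    · have := GaussianInt.eq_one_of_two_add_two_mul_I_dvd hu h
        (GaussianInt.two_add_two_mul_I_dvd_pow_sub_one hw1 k) h1
      rw [this, map_pow, map_pow]
    · have := GaussianInt.eq_one_of_two_add_two_mul_I_dvd hu h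
        (GaussianInt.two_add_two_mul_I_dvd_pow_sub_one hw1 k)
        (GaussianInt.two_add_two_mul_I_dvd_star_sub_one h1)
      rw [← star_star z, this, star_pow, map_pow, map_pow, GaussianInt.toComplex_star,
        Complex.conj_conj, add_comm]
  · obtain ⟨l, rfl⟩ := hz3 h4
    rw [← two_mul] at hz ⊢
    have hpp := GaussianInt.prime_of_nat_prime_of_mod_four_eq_three p h4
    obtain ⟨u, hu, h⟩ := GaussianInt.eq_unit_mul_prime_pow hpp l hz
    have hc : (⟨2, 2⟩ : GaussianInt) ∣ (-(p : GaussianInt)) - 1 := by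
      obtain ⟨t, ht⟩ : (4 : ℤ) ∣ -(p : ℤ) - 1 := by omega
      -- `4 = (2 + 2i)(1 - i)`.
      refine ⟨⟨t, -t⟩, ?_⟩
      ext <;> simp
      · omega
    have h' : z = (u * (-1) ^ l) * (-(p : GaussianInt)) ^ l := by
      rw [h, mul_assoc, ← mul_pow]
      simp
    have := GaussianInt.eq_one_of_two_add_two_mul_I_dvd
      (hu.mul (isUnit_one.neg.pow l)) h'
      (GaussianInt.two_add_two_mul_I_dvd_pow_sub_one hc l) h1
    have hs : ((Real.sqrt p : ℝ) : ℂ) ^ 2 = p := by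
      rw [← Complex.ofReal_pow, Real.sq_sqrt (Nat.cast_nonneg p)]
      simp
    rw [hϖ.2 h4, this, pow_mul, pow_mul]
    simp [mul_pow, hs]

/-! ### Quartic characters and the Jacobi sum `J(ρ², ρ)` -/

section QuarticCharacter

variable {K : Type*} [Field K] [Fintype K] [DecidableEq K]

omit [DecidableEq K] in
theorem ringChar_ne_two_of_card_mod_four (hK : Fintype.card K % 4 = 1) : ringChar K ≠ 2 := by
  intro h
  have := FiniteField.even_card_of_char_two h
  omega

/-- An element `u` has `1 + χ(u)` square roots. -/
theorem sum_comp_sq {R : Type*} [CommRing R] (hK : ringChar K ≠ 2) (f : K → R) :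
    ∑ a : K, f (a ^ 2) = ∑ u : K, (1 + (quadraticChar K u : R)) * f u := by
  classical
  rw [← Finset.sum_fiberwise (s := Finset.univ) (g := fun a : K => a ^ 2)]
  refine Finset.sum_congr rfl fun u _ => ?_
  have h1 : ∀ a ∈ Finset.univ.filter (fun a : K => a ^ 2 = u), f (a ^ 2) = f u := by
    intro a ha
    rw [(Finset.mem_filter.1 ha).2]
  rw [Finset.sum_congr rfl h1, Finset.sum_const, nsmul_eq_mul]
  congr 1
  have h2 := quadraticChar_card_sqrts hK u
  have h3 : {x : K | x ^ 2 = u}.toFinset = Finset.univ.filter (fun a : K => a ^ 2 = u) := by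
    ext; simp
  rw [h3] at h2
  have h4 := congrArg (Int.cast : ℤ → R) h2
  push_cast at h4
  rw [h4, add_comm]

variable {ρ : MulChar K GaussianInt}

omit [Fintype K] [DecidableEq K] in
theorem quartic_apply_pow_four (hρ : orderOf ρ = 4) {x : K} (hx : x ≠ 0) : ρ x ^ 4 = 1 := by
  have h := pow_orderOf_eq_one ρ
  rw [hρ] at h
  rw [← MulChar.pow_apply' ρ (by norm_num), h, MulChar.one_apply hx.isUnit]

/-- `ρ²` is trivial on squares since `ρ⁴ = 1`, and not trivial since `ρ` has order 4; the squares
have index at most 2. -/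
theorem quartic_sq_apply (hρ : orderOf ρ = 4) (x : K) :
    ρ x ^ 2 = (quadraticChar K x : GaussianInt) := by
  by_cases hx : x = 0
  · rw [hx, MulChar.map_zero, quadraticChar_zero, Int.cast_zero, zero_pow two_ne_zero]
  have hsq : ∀ y : K, y ≠ 0 → IsSquare y → ρ y ^ 2 = 1 := by
    rintro y hy ⟨t, rfl⟩
    have ht : t ≠ 0 := fun h => hy (by simp [h])
    rw [map_mul, ← sq, ← pow_mul, quartic_apply_pow_four hρ ht]
  by_cases h : IsSquare x
  · rw [hsq x hx h, (quadraticChar_one_iff_isSquare hx).2 h, Int.cast_one]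
  have hne : ρ ^ 2 ≠ 1 := fun h2 => by
    have := orderOf_dvd_of_pow_eq_one h2
    rw [hρ] at this
    norm_num at this
  obtain ⟨u, hu⟩ := (MulChar.ne_one_iff).1 hne
  rw [MulChar.pow_apply' ρ (by norm_num)] at hu
  have hu' : ¬ IsSquare (u : K) := fun hs => hu (hsq _ u.ne_zero hs)
  have hxu : IsSquare (x * u) := by
    rw [← quadraticChar_one_iff_isSquare (mul_ne_zero hx u.ne_zero), map_mul,
      quadraticChar_neg_one_iff_not_isSquare.2 h, quadraticChar_neg_one_iff_not_isSquare.2 hu']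
    norm_num
  have h1 := hsq _ (mul_ne_zero hx u.ne_zero) hxu
  have h2 : ρ (u : K) ^ 2 = -1 := by
    have h3 := quartic_apply_pow_four hρ u.ne_zero
    have h4 : (ρ (u : K) ^ 2 - 1) * (ρ (u : K) ^ 2 + 1) = 0 := by linear_combination h3
    rcases mul_eq_zero.1 h4 with h5 | h5
    · exact absurd (sub_eq_zero.1 h5) hu
    · exact eq_neg_of_add_eq_zero_left h5
  rw [quadraticChar_neg_one_iff_not_isSquare.2 h]
  rw [map_mul, mul_pow, h2] at h1
  push_cast
  linear_combination -h1

theorem quartic_sq_eq (hρ : orderOf ρ = 4) (x : K) :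
    (ρ ^ 2) x = (quadraticChar K x : GaussianInt) := by
  rw [MulChar.pow_apply' ρ (by norm_num), quartic_sq_apply hρ]

omit [Fintype K] [DecidableEq K] in
theorem star_quartic_apply (x : K) : star (ρ x) = ρ⁻¹ x := by
  by_cases hx : x = 0
  · rw [hx, MulChar.map_zero, MulChar.map_zero, star_zero]
  have h1 : ρ x * ρ⁻¹ x = 1 := by
    rw [← MulChar.mul_apply, mul_inv_cancel, MulChar.one_apply (Ne.isUnit hx)]
  have hu : IsUnit (ρ x) := IsUnit.of_mul_eq_one _ h1
  have h2 : ρ x * star (ρ x) = 1 := by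
    rw [GaussianInt.mul_star_eq_norm, (Zsqrtd.norm_eq_one_iff' (by norm_num) _).2 hu, Int.cast_one]
  exact hu.mul_left_cancel (h2.trans h1.symm)

omit [DecidableEq K] in
theorem exists_quarticChar (hK : Fintype.card K % 4 = 1) :
    ∃ ρ : MulChar K GaussianInt, orderOf ρ = 4 := by
  refine MulChar.exists_mulChar_orderOf K (n := 4) (by omega) (ζ := (⟨0, 1⟩ : GaussianInt)) ?_
  refine IsPrimitiveRoot.mk_of_lt _ (by norm_num) (by decide) ?_
  intro l h0 h4
  interval_cases l <;> decide

theorem quadraticChar_neg_one_eq_one (hK : Fintype.card K % 4 = 1) :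
    quadraticChar K (-1) = 1 := by
  rw [quadraticChar_one_iff_isSquare (by simp), FiniteField.isSquare_neg_one_iff]
  omega

theorem star_jacobiSum_quartic (hρ : orderOf ρ = 4) :
    star (jacobiSum (ρ ^ 2) ρ) = jacobiSum (ρ ^ 2) (ρ ^ 3) := by
  have h4 : ρ ^ 4 = 1 := by rw [← hρ, pow_orderOf_eq_one]
  have h3 : ρ⁻¹ = ρ ^ 3 := by
    rw [inv_eq_iff_mul_eq_one, ← pow_succ', h4]
  rw [jacobiSum, jacobiSum, star_sum]
  refine Finset.sum_congr rfl fun x _ => ?_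
  rw [star_mul, mul_comm, MulChar.pow_apply' ρ (by norm_num), star_pow, star_quartic_apply,
    star_quartic_apply, h3, MulChar.pow_apply' ρ (by norm_num : (3 : ℕ) ≠ 0), ← pow_mul]
  congr 1
  by_cases hx : x = 0
  · rw [hx, MulChar.map_zero, zero_pow (by norm_num), zero_pow (by norm_num)]
  · linear_combination ρ x ^ 2 * quartic_apply_pow_four hρ hx

/-- The characters `ρ²`, `ρ` and `ρ³` are all nontrivial, so `J(ρ², ρ)` times the Jacobi sum of the
inverse characters is `r`. The identity is used in `ℂ` and pulled back along the injective
`toComplex`. -/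
theorem norm_jacobiSum_quartic (hρ : orderOf ρ = 4) :
    (jacobiSum (ρ ^ 2) ρ).norm = Fintype.card K := by
  have h4 : ρ ^ 4 = 1 := by rw [← hρ, pow_orderOf_eq_one]
  have hne : ∀ k, ¬ 4 ∣ k → ρ ^ k ≠ 1 := fun k hk h => hk (hρ ▸ orderOf_dvd_of_pow_eq_one h)
  have hinj : Function.Injective GaussianInt.toComplex := GaussianInt.toComplex_injective
  have hch : ringChar ℂ ≠ ringChar K := by
    rw [ringChar.eq_zero]
    exact (CharP.ringChar_ne_zero_of_finite K).symm
  have key := jacobiSum_mul_jacobiSum_inv hch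
    (χ := (ρ ^ 2).ringHomComp GaussianInt.toComplex) (φ := ρ.ringHomComp GaussianInt.toComplex)
    ((MulChar.ringHomComp_ne_one_iff hinj).2 (hne 2 (by norm_num)))
    ((MulChar.ringHomComp_ne_one_iff hinj).2 (by simpa using hne 1 (by norm_num)))
    (by
      rw [← MulChar.ringHomComp_mul, ← pow_succ]
      exact (MulChar.ringHomComp_ne_one_iff hinj).2 (hne 3 (by norm_num)))
  rw [MulChar.ringHomComp_inv, MulChar.ringHomComp_inv, jacobiSum_ringHomComp,
    jacobiSum_ringHomComp, ← map_mul] at key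
  have h2 : (ρ ^ 2)⁻¹ = ρ ^ 2 := by
    rw [inv_eq_iff_mul_eq_one, ← pow_add, h4]
  have h3 : ρ⁻¹ = ρ ^ 3 := by
    rw [inv_eq_iff_mul_eq_one, ← pow_succ', h4]
  rw [h2, h3, ← star_jacobiSum_quartic hρ, GaussianInt.mul_star_eq_norm] at key
  have : ((jacobiSum (ρ ^ 2) ρ).norm : ℂ) = (Fintype.card K : ℤ) := by
    simpa using key
  exact_mod_cast this

/-- Expanding `∑ (ρ²(x) - 1)(ρ(1 - x) - 1)` gives `J + r`. The terms at 0 and 1 vanish; in the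
others the factors are divisible by `2` and by `1 + i`. Finally `r ≡ 1 (mod 4)`. -/
theorem dvd_jacobiSum_quartic_add_one (hK : Fintype.card K % 4 = 1) (hρ : orderOf ρ = 4) :
    (⟨2, 2⟩ : GaussianInt) ∣ -jacobiSum (ρ ^ 2) ρ - 1 := by
  have hne : ∀ k, ¬ 4 ∣ k → ρ ^ k ≠ 1 := fun k hk h => hk (hρ ▸ orderOf_dvd_of_pow_eq_one h)
  have hK2 := ringChar_ne_two_of_card_mod_four hK
  have hsum : ∑ x : K, ((ρ ^ 2) x - 1) * (ρ (1 - x) - 1) =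
      jacobiSum (ρ ^ 2) ρ + (Fintype.card K : GaussianInt) := by
    have h1 : ∑ x : K, ρ (1 - x) = 0 := by
      refine ((Equiv.subLeft (1 : K)).sum_comp (fun x => ρ x)).trans ?_
      exact MulChar.sum_eq_zero_of_ne_one (by simpa using hne 1 (by norm_num))
    have h2 : ∑ x : K, (ρ ^ 2) x = 0 := MulChar.sum_eq_zero_of_ne_one (hne 2 (by norm_num))
    calc _ = ∑ x : K, ((ρ ^ 2) x * ρ (1 - x) - (ρ ^ 2) x - ρ (1 - x) + 1) :=
          Finset.sum_congr rfl fun x _ => by ring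
      _ = _ := by
          rw [Finset.sum_add_distrib, Finset.sum_sub_distrib, Finset.sum_sub_distrib, h1, h2]
          simp [jacobiSum]
  have hrest : (⟨2, 2⟩ : GaussianInt) ∣
      ∑ x ∈ Finset.univ \ {0, 1}, ((ρ ^ 2) x - 1) * (ρ (1 - x) - 1) := by
    refine Finset.dvd_sum fun x hx => ?_
    simp only [Finset.mem_sdiff, Finset.mem_univ, true_and, Finset.mem_insert,
      Finset.mem_singleton, not_or] at hx
    have e1 : (2 : GaussianInt) ∣ (ρ ^ 2) x - 1 := by
      rw [quartic_sq_eq hρ]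
      rcases quadraticChar_dichotomy hx.1 with h | h <;> rw [h]
      · simp
      · exact ⟨-1, by push_cast; ring⟩
    have e2 : (⟨1, 1⟩ : GaussianInt) ∣ ρ (1 - x) - 1 := by
      have h4 := quartic_apply_pow_four hρ (sub_ne_zero.2 (Ne.symm hx.2))
      set w := ρ (1 - x)
      -- `w` is one of the four units, and every unit is 1 modulo `1 + i`.
      have hf : (w - 1) * (w + 1) * (w - ⟨0, 1⟩) * (w + ⟨0, 1⟩) = 0 := by
        have hI : (⟨0, 1⟩ : GaussianInt) ^ 2 = -1 := by decide
        linear_combination h4 - (w ^ 2 - 1) * hI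
      rcases mul_eq_zero.1 hf with hf | hf
      · rcases mul_eq_zero.1 hf with hf | hf
        · rcases mul_eq_zero.1 hf with hf | hf
          · rw [hf]; exact dvd_zero _
          · rw [eq_neg_of_add_eq_zero_left hf]
            exact ⟨⟨-1, 1⟩, by decide⟩
        · rw [sub_eq_zero.1 hf]
          exact ⟨⟨0, 1⟩, by decide⟩
      · rw [eq_neg_of_add_eq_zero_left hf]
        exact ⟨⟨-1, 0⟩, by decide⟩
    have := mul_dvd_mul e1 e2
    rwa [show (2 : GaussianInt) * ⟨1, 1⟩ = ⟨2, 2⟩ by decide] at this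
  have hsplit : ∑ x : K, ((ρ ^ 2) x - 1) * (ρ (1 - x) - 1) =
      ∑ x ∈ Finset.univ \ {0, 1}, ((ρ ^ 2) x - 1) * (ρ (1 - x) - 1) := by
    rw [← Finset.sum_sdiff (Finset.subset_univ ({0, 1} : Finset K)),
      Finset.sum_pair zero_ne_one]
    simp
  rw [hsplit] at hsum
  rw [hsum] at hrest
  have h4 : (⟨2, 2⟩ : GaussianInt) ∣ (Fintype.card K : GaussianInt) - 1 := by
    obtain ⟨t, ht⟩ : ∃ t, Fintype.card K = 4 * t + 1 := ⟨Fintype.card K / 4, by omega⟩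
    rw [ht]
    have : (4 : GaussianInt) = ⟨2, 2⟩ * ⟨1, -1⟩ := by decide
    refine ⟨⟨1, -1⟩ * t, ?_⟩
    push_cast
    rw [this]
    ring
  have : -jacobiSum (ρ ^ 2) ρ - 1 = ((Fintype.card K : GaussianInt) - 1) -
    (jacobiSum (ρ ^ 2) ρ + (Fintype.card K : GaussianInt)) := by ring
  rw [this]
  exact dvd_sub h4 hrest

theorem add_star_eq (z : GaussianInt) : z + star z = ((2 * z.re : ℤ) : GaussianInt) := by
  ext <;> simp
  ring

omit [DecidableEq K] in
theorem jacobiSum_add_jacobiSum_cube :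
    jacobiSum (ρ ^ 2) ρ + jacobiSum (ρ ^ 2) (ρ ^ 3) =
      ∑ u : K, (1 + (ρ ^ 2) u) * (ρ u * (ρ ^ 2) (1 - u)) := by
  rw [jacobiSum_comm, jacobiSum_comm _ (ρ ^ 3), jacobiSum, jacobiSum, ← Finset.sum_add_distrib]
  refine Finset.sum_congr rfl fun u _ => ?_
  rw [MulChar.pow_apply' ρ (by norm_num : (3 : ℕ) ≠ 0), MulChar.pow_apply' ρ (by norm_num) u]
  ring

/-- Substituting squares twice, with `χ(v) = ρ(v²)`, gives `∑ (1 + χ(u))(1 + ρ(u)) χ(u - 1)`. The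
pieces are `∑ χ(1 - u) = 0`, `J(χ, χ) = -χ(-1) = -1`, and `J` plus its conjugate. -/
theorem sum_quadraticChar_pow_four_sub_one (hK : Fintype.card K % 4 = 1) (hρ : orderOf ρ = 4) :
    ∑ a : K, quadraticChar K (a ^ 4 - 1) = -1 + 2 * (jacobiSum (ρ ^ 2) ρ).re := by
  have hne : ∀ k, ¬ 4 ∣ k → ρ ^ k ≠ 1 := fun k hk h => hk (hρ ▸ orderOf_dvd_of_pow_eq_one h)
  have hK2 := ringChar_ne_two_of_card_mod_four hK
  have h4 : ρ ^ 4 = 1 := by rw [← hρ, pow_orderOf_eq_one]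
  have hm1 : (ρ ^ 2) (-1) = 1 := by
    rw [quartic_sq_eq hρ, quadraticChar_neg_one_eq_one hK, Int.cast_one]
  have hsub : ∀ u : K, (ρ ^ 2) (u - 1) = (ρ ^ 2) (1 - u) := by
    intro u
    rw [show u - 1 = -1 * (1 - u) by ring, map_mul, hm1, one_mul]
  have key : ((∑ a : K, quadraticChar K (a ^ 4 - 1) : ℤ) : GaussianInt) =
      ((-1 + 2 * (jacobiSum (ρ ^ 2) ρ).re : ℤ) : GaussianInt) := by
    push_cast
    simp only [← quartic_sq_eq hρ]
    have e1 : ∑ a : K, (ρ ^ 2) (a ^ 4 - 1) =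
        ∑ v : K, (1 + ρ (v ^ 2)) * (ρ ^ 2) (v ^ 2 - 1) := by
      have := sum_comp_sq hK2 (fun v : K => (ρ ^ 2) (v ^ 2 - 1))
      simp only [← pow_mul] at this
      rw [this]
      refine Finset.sum_congr rfl fun v _ => ?_
      rw [← quartic_sq_eq hρ v, map_pow, MulChar.pow_apply' ρ (by norm_num)]
    have e2 : ∑ u : K, (ρ ^ 2) (1 - u) = 0 := by
      refine ((Equiv.subLeft (1 : K)).sum_comp (fun x => (ρ ^ 2) x)).trans ?_
      exact MulChar.sum_eq_zero_of_ne_one (hne 2 (by norm_num))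
    have e3 : ∑ u : K, (ρ ^ 2) u * (ρ ^ 2) (1 - u) = -1 := by
      have h2 : (ρ ^ 2)⁻¹ = ρ ^ 2 := by
        rw [inv_eq_iff_mul_eq_one, ← pow_add, h4]
      have := jacobiSum_nontrivial_inv (hne 2 (by norm_num))
      rw [h2, hm1] at this
      exact this
    rw [e1, sum_comp_sq hK2 (fun v : K => (1 + ρ v) * (ρ ^ 2) (v - 1))]
    have e4 : ∀ u : K, (1 + (quadraticChar K u : GaussianInt)) *
        ((1 + ρ u) * (ρ ^ 2) (u - 1)) = (ρ ^ 2) (1 - u) + (ρ ^ 2) u * (ρ ^ 2) (1 - u) +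
          (1 + (ρ ^ 2) u) * (ρ u * (ρ ^ 2) (1 - u)) := by
      intro u
      rw [← quartic_sq_eq hρ u, hsub]
      ring
    rw [Finset.sum_congr rfl fun u _ => e4 u, Finset.sum_add_distrib, Finset.sum_add_distrib,
      e2, e3, ← jacobiSum_add_jacobiSum_cube, ← star_jacobiSum_quartic hρ, add_star_eq]
    push_cast
    ring
  exact_mod_cast key

/-- With `x = 2y` the cubic is `2² · 2y(y² + 1)`, and `χ(y) = ρ(y²)` makes it a function of `y²`.
After `v = -u` it is the same Jacobi sum up to the factor `χ(2) ρ(-1)`. -/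
theorem sum_quadraticChar_cubic (hK : Fintype.card K % 4 = 1) (hρ : orderOf ρ = 4) :
    ∑ x : K, quadraticChar K (x ^ 3 + 4 * x) = 2 * (jacobiSum (ρ ^ 2) ρ).re := by
  have hK2 := ringChar_ne_two_of_card_mod_four hK
  have h20 : (2 : K) ≠ 0 := Ring.two_ne_zero hK2
  -- The factor is `ρ(-4)`, and `-4 = (1 + i)^4` when `i² = -1`.
  have h24 : (ρ ^ 2) 2 * ρ (-1) = 1 := by
    obtain ⟨i, hi⟩ : IsSquare (-1 : K) := by
      rw [FiniteField.isSquare_neg_one_iff]; omega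
    rw [MulChar.pow_apply' ρ (by norm_num), ← map_pow, ← map_mul,
      show (2 : K) ^ 2 * -1 = (1 + i) ^ 4 by linear_combination (i ^ 2 + 4 * i + 5) * hi,
      map_pow, quartic_apply_pow_four hρ]
    intro h
    have hh : i = -1 := by linear_combination h
    rw [hh] at hi
    exact h20 (by linear_combination -hi)
  have key : ((∑ x : K, quadraticChar K (x ^ 3 + 4 * x) : ℤ) : GaussianInt) =
      ((2 * (jacobiSum (ρ ^ 2) ρ).re : ℤ) : GaussianInt) := by
    push_cast
    rw [← Equiv.sum_comp (Equiv.mulLeft₀ (2 : K) h20)]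
    simp only [← quartic_sq_eq hρ]
    have e1 : ∀ y : K, (ρ ^ 2) ((Equiv.mulLeft₀ (2 : K) h20) y ^ 3 +
        4 * (Equiv.mulLeft₀ (2 : K) h20) y) =
        (ρ ^ 2) 2 * (ρ (y ^ 2) * (ρ ^ 2) (y ^ 2 + 1)) := by
      intro y
      have h22 : (ρ ^ 2) (2 ^ 2) = 1 := by
        rw [quartic_sq_eq hρ, quadraticChar_sq_one' h20, Int.cast_one]
      have : (Equiv.mulLeft₀ (2 : K) h20) y ^ 3 + 4 * (Equiv.mulLeft₀ (2 : K) h20) y =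
        2 ^ 2 * (2 * (y * (y ^ 2 + 1))) := by simp; ring
      rw [this, map_mul, h22, one_mul, map_mul, map_mul, map_pow,
        MulChar.pow_apply' ρ (by norm_num) y]
    rw [Finset.sum_congr rfl fun y _ => e1 y, ← Finset.mul_sum,
      sum_comp_sq hK2 (fun v : K => ρ v * (ρ ^ 2) (v + 1)), ← Equiv.sum_comp (Equiv.neg K)]
    have e2 : ∀ u : K, (1 + (quadraticChar K ((Equiv.neg K) u) : GaussianInt)) *
        (ρ ((Equiv.neg K) u) * (ρ ^ 2) ((Equiv.neg K) u + 1)) =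
        ρ (-1) * ((1 + (ρ ^ 2) u) * (ρ u * (ρ ^ 2) (1 - u))) := by
      intro u
      rw [Equiv.neg_apply, ← neg_one_mul u, map_mul, map_mul, quadraticChar_neg_one_eq_one hK,
        one_mul, ← quartic_sq_eq hρ u, neg_one_mul, neg_add_eq_sub]
      ring
    rw [Finset.sum_congr rfl fun y _ => e2 y, ← Finset.mul_sum, ← jacobiSum_add_jacobiSum_cube,
      ← star_jacobiSum_quartic hρ, add_star_eq, ← mul_assoc, h24]
    push_cast
    ring
  exact_mod_cast key

end QuarticCharacter

/-! ### Nondivisibility of the Jacobi sum by `p` when `p ≡ 1 (mod 4)` -/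

section Supersingular

/-- In base `p` all `k` digits of the two entries are `(p - 1)/2` and `(p - 1)/4`, so Lucas' theorem
reduces the coefficient to a power of `C((p-1)/2, (p-1)/4)`, which divides a factorial prime to `p`.
-/
theorem not_dvd_choose_div_four {p : ℕ} [hp : Fact p.Prime] (hp4 : p % 4 = 1) (k : ℕ) :
    ¬ p ∣ ((p ^ k - 1) / 2).choose ((p ^ k - 1) / 4) := by
  induction k with
  | zero => simpa using hp.out.one_lt.ne'
  | succ k ih =>
    obtain ⟨t, ht⟩ : ∃ t, p = 4 * t + 1 := ⟨p / 4, by omega⟩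
    obtain ⟨s, hs⟩ : ∃ s, p ^ k = 4 * s + 1 := by
      have : p ^ k % 4 = 1 := by simp [Nat.pow_mod, hp4]
      exact ⟨p ^ k / 4, by omega⟩
    have h1 : (p ^ (k + 1) - 1) / 4 = t + p * s := by
      rw [pow_succ', hs]
      have : p * (4 * s + 1) = 4 * (p * s) + p := by ring
      omega
    have h2 : (p ^ (k + 1) - 1) / 2 = 2 * t + p * (2 * s) := by
      rw [pow_succ', hs]
      have : p * (4 * s + 1) = 4 * (p * s) + p := by ring
      have : p * (2 * s) = 2 * (p * s) := by ring
      omega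
    rw [h1, h2]
    have hl := Choose.choose_modEq_choose_mod_mul_choose_div_nat (n := 2 * t + p * (2 * s))
      (k := t + p * s) (p := p)
    rw [Nat.add_mul_mod_self_left, Nat.add_mul_mod_self_left,
      Nat.add_mul_div_left _ _ hp.out.pos, Nat.add_mul_div_left _ _ hp.out.pos,
      Nat.mod_eq_of_lt (by omega : 2 * t < p), Nat.mod_eq_of_lt (by omega : t < p),
      Nat.div_eq_of_lt (by omega : 2 * t < p), Nat.div_eq_of_lt (by omega : t < p),
      zero_add, zero_add] at hl
    rw [hl.dvd_iff dvd_rfl, hp.out.dvd_mul]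
    rintro (h | h)
    · have h5 : p ∣ (2 * t).factorial := h.trans ⟨_, (by
        have := Nat.choose_mul_factorial_mul_factorial (by omega : t ≤ 2 * t)
        rw [← this, mul_assoc])⟩
      rw [hp.out.dvd_factorial] at h5
      omega
    · apply ih
      rw [hs]
      convert h using 2 <;> omega

variable {K : Type*} [Field K] [Fintype K] [DecidableEq K]

theorem sum_pow_univ {i : ℕ} (hi : 0 < i) :
    ∑ x : K, x ^ i = if Fintype.card K - 1 ∣ i then -1 else 0 := by
  rw [← FiniteField.sum_pow_units K i]
  have h : ∑ x : K, x ^ i = ∑ x ∈ Finset.univ \ {0}, x ^ i := by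
    rw [← Finset.sum_sdiff (Finset.subset_univ ({0} : Finset K)), Finset.sum_singleton,
      zero_pow hi.ne', add_zero]
  rw [h]
  symm
  refine Finset.sum_bij (fun u _ => (u : K)) (by simp) (fun a _ b _ h => Units.ext h) ?_
    (fun _ _ => rfl)
  intro b hb
  have hb' : b ≠ 0 := by simpa using hb
  exact ⟨Units.mk0 b hb', by simp, rfl⟩

/-- In the binomial expansion a power sum `∑ a^(4j)` survives only if `j > 0` and `r - 1 ∣ 4j`. As
`j ≤ (r - 1)/2`, this leaves `j = (r - 1)/4` and `j = (r - 1)/2`. -/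
theorem sum_pow_four_sub_one_pow (hK : Fintype.card K % 4 = 1) :
    ∑ a : K, (a ^ 4 - 1) ^ (Fintype.card K / 2) =
      -(-1) ^ ((Fintype.card K - 1) / 4) *
        (((Fintype.card K - 1) / 2).choose ((Fintype.card K - 1) / 4) : K) - 1 := by
  obtain ⟨t, ht⟩ : ∃ t, Fintype.card K = 4 * t + 1 := ⟨Fintype.card K / 4, by omega⟩
  have ht0 : 0 < t := by
    have := Fintype.one_lt_card (α := K)
    omega
  have e1 : Fintype.card K / 2 = 2 * t := by omega
  have e2 : (Fintype.card K - 1) / 4 = t := by omega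
  have e3 : (Fintype.card K - 1) / 2 = 2 * t := by omega
  have e4 : Fintype.card K - 1 = 4 * t := by omega
  rw [e1, e2, e3]
  simp only [sub_eq_add_neg, add_pow]
  rw [Finset.sum_comm]
  have hterm : ∀ j ∈ Finset.range (2 * t + 1),
      ∑ a : K, (a ^ 4) ^ j * (-1) ^ (2 * t - j) * ((2 * t).choose j : K) =
      (if j = t then -(-1) ^ t * ((2 * t).choose t : K) else 0) +
        (if j = 2 * t then -1 else 0) := by
    intro j hj
    rw [Finset.mem_range] at hj
    rw [← Finset.sum_mul, ← Finset.sum_mul]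
    simp only [← pow_mul]
    rcases Nat.eq_zero_or_pos j with rfl | hj0
    · have : (Fintype.card K : K) = 0 := FiniteField.cast_card_eq_zero K
      simp [this, ht0.ne, ht0.ne']
    · rw [sum_pow_univ (by omega), e4]
      by_cases h1 : j = t
      · subst h1
        have h2 : j ≠ 2 * j := by omega
        have h3 : 2 * j - j = j := by omega
        simp [h2, h3]
      · by_cases h2 : j = 2 * t
        · subst h2
          have h3 : 4 * t ∣ 4 * (2 * t) := ⟨2, by ring⟩
          simp [h1, h3]
        · have h3 : ¬ 4 * t ∣ 4 * j := by
            rw [Nat.mul_dvd_mul_iff_left (by norm_num)]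
            rintro ⟨c, rfl⟩
            have hc1 : c < 3 := by
              by_contra hc
              have : t * 3 ≤ t * c := Nat.mul_le_mul_left _ (by omega)
              omega
            interval_cases c <;> omega
          rw [if_neg h3]
          simp [h1, h2]
  rw [Finset.sum_congr rfl hterm, Finset.sum_add_distrib, Finset.sum_ite_eq', Finset.sum_ite_eq']
  rw [if_pos (Finset.mem_range.2 (by omega)), if_pos (Finset.mem_range.2 (by omega))]

/-- Euler's criterion turns the character sum, read in `K`, into a power sum. If `p ∣ z` its value
is `-1`, so the central binomial coefficient vanishes modulo `p`. -/
theorem not_dvd_of_sum_quadraticChar {p k : ℕ} [hp : Fact p.Prime] [CharP K p] (hp4 : p % 4 = 1)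
    (hK : Fintype.card K = p ^ k) {z : GaussianInt}
    (hz : ∑ a : K, quadraticChar K (a ^ 4 - 1) = -1 - 2 * z.re) :
    ¬ (p : GaussianInt) ∣ z := by
  rintro ⟨c, rfl⟩
  have hK4 : Fintype.card K % 4 = 1 := by simp [hK, Nat.pow_mod, hp4]
  have h1 := congrArg (Int.cast : ℤ → K) hz
  push_cast at h1
  simp only [quadraticChar_eq_pow_of_char_ne_two' (ringChar_ne_two_of_card_mod_four hK4)] at h1
  rw [sum_pow_four_sub_one_pow hK4] at h1
  have h2 : (((p : GaussianInt) * c).re : K) = 0 := by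
    simp
  rw [h2, mul_zero, sub_zero, sub_eq_iff_eq_add, neg_add_cancel] at h1
  have h3 : (((Fintype.card K - 1) / 2).choose ((Fintype.card K - 1) / 4) : K) = 0 := by
    rcases mul_eq_zero.1 h1 with h | h
    · exact absurd (neg_eq_zero.1 h) (pow_ne_zero _ (by simp))
    · exact h
  rw [CharP.cast_eq_zero_iff K p, hK] at h3
  exact not_dvd_choose_div_four hp4 k h3

end Supersingular

/-! ### The Frobenius trace and the points of `y² = x³ + 4x` -/

theorem exists_gaussianInt_of_card {K : Type*} [Field K] [Fintype K] [DecidableEq K]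
    (hK : Fintype.card K % 4 = 1) :
    ∃ z : GaussianInt, z.norm = Fintype.card K ∧ (⟨2, 2⟩ : GaussianInt) ∣ z - 1 ∧
      ∑ a : K, quadraticChar K (a ^ 4 - 1) = -1 - 2 * z.re ∧
      ∑ x : K, quadraticChar K (x ^ 3 + 4 * x) = -(2 * z.re) := by
  obtain ⟨ρ, hρ⟩ := exists_quarticChar (K := K) hK
  -- The sign is forced: `-J`, not `J`, is congruent to 1 modulo `2 + 2i`.
  refine ⟨-jacobiSum (ρ ^ 2) ρ, ?_, dvd_jacobiSum_quartic_add_one hK hρ, ?_, ?_⟩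
  · rw [Zsqrtd.norm_neg, norm_jacobiSum_quartic hρ]
  · rw [sum_quadraticChar_pow_four_sub_one hK hρ, Zsqrtd.re_neg]
    ring
  · rw [sum_quadraticChar_cubic hK hρ, Zsqrtd.re_neg]
    ring

/-- The two character sums attached to `y² = x³ + 4x` over a field with `p ^ k` elements, in terms
of the Frobenius eigenvalues. -/
theorem sum_quadraticChar_eq_frobenius {p k : ℕ} [hp : Fact p.Prime] {K : Type*} [Field K]
    [Fintype K] [DecidableEq K] [CharP K p] (hcard : Fintype.card K = p ^ k)
    (hK : Fintype.card K % 4 = 1) (hk : p % 4 = 3 → Even k) {ϖ : ℂ} (hϖ : IsFrobeniusPi p ϖ) :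
    ((∑ a : K, quadraticChar K (a ^ 4 - 1) : ℤ) : ℂ) =
        -1 - (ϖ ^ k + (starRingEnd ℂ ϖ) ^ k) ∧
      ((∑ x : K, quadraticChar K (x ^ 3 + 4 * x) : ℤ) : ℂ) =
        -(ϖ ^ k + (starRingEnd ℂ ϖ) ^ k) := by
  obtain ⟨z, hz, h1, h2, h3⟩ := exists_gaussianInt_of_card hK
  have hp2 : p ≠ 2 := by
    rintro rfl
    exact ringChar_ne_two_of_card_mod_four hK (ringChar.eq K 2)
  have hz' : z.norm = (p : ℤ) ^ k := by
    rw [hz, hcard]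
    push_cast
    rfl
  have h := two_mul_re_eq_of_isFrobeniusPi hp2 hϖ hz' h1
    (fun hp4 => not_dvd_of_sum_quadraticChar hp4 hcard h2) hk
  rw [h2, h3, ← h]
  constructor <;> push_cast <;> ring

/-- The discriminant is `-2^12`, so every affine solution is a nonsingular point, and each `x`
carries `1 + χ(x³ + 4x)` of them. The extra 1 is the point at infinity. -/
theorem card_curveE_point {p : ℕ} [hp : Fact p.Prime] (hp2 : p ≠ 2) :
    (Nat.card (curveE p).Point : ℤ) =
      p + 1 + ∑ x : ZMod p, quadraticChar (ZMod p) (x ^ 3 + 4 * x) := by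
  have hchar : ringChar (ZMod p) ≠ 2 := by
    rw [ZMod.ringChar_zmod_n]
    exact hp2
  have h2 : (2 : ZMod p) ≠ 0 := Ring.two_ne_zero hchar
  have hΔ : (curveE p).Δ ≠ 0 := by
    have : (curveE p).Δ = -(2 ^ 12) := by
      simp only [WeierstrassCurve.Δ, WeierstrassCurve.b₂, WeierstrassCurve.b₄,
        WeierstrassCurve.b₆, WeierstrassCurve.b₈, curveE]
      ring
    rw [this]
    exact neg_ne_zero.2 (pow_ne_zero _ h2)
  have heq : ∀ x y : ZMod p, (curveE p).Nonsingular x y ↔ y ^ 2 = x ^ 3 + 4 * x := by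
    intro x y
    rw [← WeierstrassCurve.Affine.equation_iff_nonsingular_of_Δ_ne_zero hΔ,
      WeierstrassCurve.Affine.equation_iff]
    simp [curveE]
  let e : (curveE p).Point ≃ Option (Σ x : ZMod p, {y : ZMod p // y ^ 2 = x ^ 3 + 4 * x}) :=
    { toFun := fun P => match P with
        | .zero => none
        | .some x y h => some ⟨x, y, (heq x y).1 h⟩
      invFun := fun o => match o with
        | none => .zero
        | some ⟨x, y, h⟩ => .some x y ((heq x y).2 h)
      left_inv := by rintro (_ | _) <;> rfl
      right_inv := by rintro (_ | _) <;> rfl }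
  rw [Nat.card_congr e, Nat.card_eq_fintype_card, Fintype.card_option, Fintype.card_sigma]
  have hx : ∀ x : ZMod p, (Fintype.card {y : ZMod p // y ^ 2 = x ^ 3 + 4 * x} : ℤ) =
      quadraticChar (ZMod p) (x ^ 3 + 4 * x) + 1 := by
    intro x
    rw [← quadraticChar_card_sqrts hchar, Set.toFinset_card]
    rfl
  push_cast
  rw [Finset.sum_congr rfl fun x _ => hx x, Finset.sum_add_distrib]
  simp
  ring

theorem isFrobeniusPi_mul_conj {p : ℕ} [hp : Fact p.Prime] (hp2 : p ≠ 2) {ϖ : ℂ}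
    (hϖ : IsFrobeniusPi p ϖ) : ϖ * starRingEnd ℂ ϖ = p := by
  have := hp.out.eq_two_or_odd
  rcases (by omega : p % 4 = 1 ∨ p % 4 = 3) with h | h
  · obtain ⟨z, hz, -, rfl⟩ := hϖ.1 h
    rw [← GaussianInt.toComplex_star, ← GaussianInt.toComplex_mul, GaussianInt.mul_star_eq_norm,
      hz]
    simp
  · rw [hϖ.2 h, map_mul, Complex.conj_I, Complex.conj_ofReal]
    have hs : ((Real.sqrt p : ℝ) : ℂ) ^ 2 = p := by
      rw [← Complex.ofReal_pow, Real.sq_sqrt (Nat.cast_nonneg p)]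
      simp
    linear_combination -(Real.sqrt p : ℂ) ^ 2 * Complex.I_sq + hs

/-- For `p ≡ 1 (mod 4)` this is the character sum formula with exponent 1. For `p ≡ 3 (mod 4)` that
formula is not available for odd exponents, but `x ↦ -x` changes the sign of every term, and `π` has
trace 0. -/
theorem card_curveE_point_eq_frobenius {p : ℕ} [hp : Fact p.Prime] (hp2 : p ≠ 2) {ϖ : ℂ}
    (hϖ : IsFrobeniusPi p ϖ) :
    (Nat.card (curveE p).Point : ℂ) = p + 1 - (ϖ + starRingEnd ℂ ϖ) := by
  have hcard := congrArg (Int.cast : ℤ → ℂ) (card_curveE_point hp2)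
  push_cast at hcard
  rw [hcard]
  have := hp.out.eq_two_or_odd
  rcases (by omega : p % 4 = 1 ∨ p % 4 = 3) with h | h
  · have hK : Fintype.card (ZMod p) % 4 = 1 := by rw [ZMod.card, h]
    have := (sum_quadraticChar_eq_frobenius (k := 1) (by rw [ZMod.card, pow_one]) hK
      (by omega) hϖ).2
    rw [pow_one, pow_one] at this
    push_cast at this
    rw [this]
    ring
  · have hneg : quadraticChar (ZMod p) (-1) = -1 := by
      rw [quadraticChar_neg_one_iff_not_isSquare, FiniteField.isSquare_neg_one_iff, ZMod.card, h]
      simp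
    have hs : ∑ x : ZMod p, quadraticChar (ZMod p) (x ^ 3 + 4 * x) = 0 := by
      have h1 : ∑ x : ZMod p, quadraticChar (ZMod p) (x ^ 3 + 4 * x) =
          -∑ x : ZMod p, quadraticChar (ZMod p) (x ^ 3 + 4 * x) := by
        rw [← Finset.sum_neg_distrib, ← Equiv.sum_comp (Equiv.neg (ZMod p))]
        refine Finset.sum_congr rfl fun x _ => ?_
        rw [Equiv.neg_apply, show (-x) ^ 3 + 4 * -x = -1 * (x ^ 3 + 4 * x) by ring, map_mul, hneg]
        ring
      omega
    have hs' := congrArg (Int.cast : ℤ → ℂ) hs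
    push_cast at hs'
    rw [hs', hϖ.2 h, map_mul, Complex.conj_I, Complex.conj_ofReal]
    ring

/-! ### Quadratic Gauss periods -/

section Periods

variable (p : ℕ) [Fact p.Prime] (K : Type*) [Field K] [Algebra (ZMod p) K]

/-- The canonical additive character, bundled. -/
noncomputable def canonicalAddChar : AddChar K ℂ :=
  (ZMod.stdAddChar (N := p)).compAddMonoidHom (Algebra.trace (ZMod p) K).toAddMonoidHom

theorem canonicalAddChar_apply (x : K) : canonicalAddChar p K x = canonicalChar p x := rfl

variable [Fintype K]

theorem canonicalAddChar_isPrimitive : (canonicalAddChar p K).IsPrimitive := by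
  apply AddChar.IsPrimitive.of_ne_one
  intro h
  obtain ⟨x, hx⟩ := Algebra.trace_surjective (ZMod p) K 1
  have h1 : canonicalAddChar p K x = ZMod.stdAddChar (1 : ZMod p) := by
    rw [canonicalAddChar_apply, canonicalChar, hx]
  rw [h, AddChar.one_apply, ← AddChar.map_zero_eq_one (ZMod.stdAddChar (N := p))] at h1
  exact zero_ne_one (ZMod.injective_stdAddChar h1)

/-- The quadratic Gauss sum of `K` for the canonical additive character. -/
noncomputable def quadraticGaussSum [DecidableEq K] : ℂ :=
  gaussSum ((quadraticChar K).ringHomComp (Int.castRingHom ℂ)) (canonicalAddChar p K)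

variable {K} [DecidableEq K]

theorem quadraticGaussSum_sq (hK : Fintype.card K % 4 = 1) :
    quadraticGaussSum p K ^ 2 = Fintype.card K := by
  have h2 := ringChar_ne_two_of_card_mod_four hK
  have hinj : Function.Injective (Int.castRingHom ℂ) := Int.cast_injective
  rw [quadraticGaussSum, gaussSum_sq
    ((MulChar.ringHomComp_ne_one_iff hinj).2 (quadraticChar_ne_one h2))
    ((quadraticChar_isQuadratic K).comp _) (canonicalAddChar_isPrimitive p K),
    MulChar.ringHomComp_apply, quadraticChar_neg_one_eq_one hK]
  simp

theorem sum_quadraticChar_mul_canonicalAddChar (u : K)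
    (hu : u ≠ 0) :
    ∑ z : K, (quadraticChar K z : ℂ) * canonicalAddChar p K (z * u) =
      (quadraticChar K u : ℂ) * quadraticGaussSum p K := by
  have h := gaussSum_mulShift ((quadraticChar K).ringHomComp (Int.castRingHom ℂ))
    (canonicalAddChar p K) (Units.mk0 u hu)
  have h1 : (quadraticChar K u : ℂ) ^ 2 = 1 := by
    exact_mod_cast quadraticChar_sq_one hu
  rw [quadraticGaussSum, ← h, ← mul_assoc, MulChar.ringHomComp_apply, Units.val_mk0,
    eq_intCast, ← sq, h1, one_mul, gaussSum]
  refine Finset.sum_congr rfl fun z _ => ?_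
  rw [AddChar.mulShift_apply, MulChar.ringHomComp_apply, eq_intCast, mul_comm u]

variable {α : Kˣ} (hα : ∀ x : Kˣ, x ∈ Subgroup.zpowers α)
include hα

omit [Fintype K] [DecidableEq K] in
theorem mem_zpowers_sq_iff_isSquare (z : Kˣ) :
    z ∈ Subgroup.zpowers (α ^ 2) ↔ IsSquare (z : K) := by
  constructor
  · rintro ⟨k, rfl⟩
    refine ⟨((α ^ k : Kˣ) : K), ?_⟩
    rw [← Units.val_mul, ← mul_zpow, ← sq]
  · rintro ⟨y, hy⟩
    have hy0 : y ≠ 0 := by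
      rintro rfl
      exact z.ne_zero (by rw [hy, mul_zero])
    obtain ⟨k, hk⟩ := hα (Units.mk0 y hy0)
    refine ⟨k, ?_⟩
    apply Units.ext
    have hk' : ((α ^ k : Kˣ) : K) = y := congrArg Units.val hk
    rw [hy, ← hk', ← Units.val_mul, ← mul_zpow, ← sq]

theorem quadraticChar_generator (hK : Fintype.card K % 4 = 1) : quadraticChar K (α : K) = -1 := by
  rw [quadraticChar_neg_one_iff_not_isSquare]
  intro hs
  obtain ⟨a, ha⟩ := quadraticChar_exists_neg_one' (ringChar_ne_two_of_card_mod_four hK)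
  obtain ⟨k, rfl⟩ := hα a
  rw [quadraticChar_neg_one_iff_not_isSquare] at ha
  apply ha
  obtain ⟨y, hy⟩ := (mem_zpowers_sq_iff_isSquare hα α).2 hs
  have : (fun x : ℤ => α ^ x) k ∈ Subgroup.zpowers (α ^ 2) := by
    refine ⟨y * k, ?_⟩
    simp only at hy ⊢
    rw [zpow_mul, hy]
  exact (mem_zpowers_sq_iff_isSquare hα _).1 this

/-- The weight `1 + χ(z)` is 2 on nonzero squares, 0 on nonsquares and 1 at `z = 0`. -/
theorem two_mul_gaussPeriod_add_one (u : K) :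
    2 * gaussPeriod p α 2 u + 1 =
      ∑ z : K, (1 + (quadraticChar K z : ℂ)) * canonicalAddChar p K (z * u) := by
  have h1 : ∑ z : K, (1 + (quadraticChar K z : ℂ)) * canonicalAddChar p K (z * u) =
      1 + ∑ z : Kˣ, (1 + (quadraticChar K (z : K) : ℂ)) * canonicalAddChar p K (z * u) := by
    rw [← Finset.sum_sdiff (Finset.subset_univ ({0} : Finset K)), Finset.sum_singleton,
      zero_mul, AddChar.map_zero_eq_one, quadraticChar_zero, Int.cast_zero, add_zero, one_mul,
      add_comm]
    congr 1
    symm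
    refine Finset.sum_bij (fun u _ => (u : K)) (by simp) (fun a _ b _ h => Units.ext h) ?_
      (fun _ _ => rfl)
    intro b hb
    have hb' : b ≠ 0 := by simpa using hb
    exact ⟨Units.mk0 b hb', by simp, rfl⟩
  rw [h1, add_comm, gaussPeriod, Finset.mul_sum, Finset.sum_filter]
  congr 1
  refine Finset.sum_congr (Finset.ext fun _ => by simp) fun z _ => ?_
  rw [← canonicalAddChar_apply]
  by_cases hz : IsSquare (z : K)
  · rw [if_pos ((mem_zpowers_sq_iff_isSquare hα z).2 hz),
      (quadraticChar_one_iff_isSquare z.ne_zero).2 hz]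
    push_cast
    ring
  · rw [if_neg (fun h => hz ((mem_zpowers_sq_iff_isSquare hα z).1 h)),
      quadraticChar_neg_one_iff_not_isSquare.2 hz]
    push_cast
    ring

theorem two_mul_gaussPeriod_of_ne_zero {u : K} (hu : u ≠ 0) :
    2 * gaussPeriod p α 2 u = -1 + (quadraticChar K u : ℂ) * quadraticGaussSum p K := by
  have h := two_mul_gaussPeriod_add_one p hα u
  have h0 : ∑ z : K, canonicalAddChar p K (z * u) = 0 := by
    rw [AddChar.sum_mulShift u (canonicalAddChar_isPrimitive p K), if_neg hu, Nat.cast_zero]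
  simp only [add_mul, one_mul, Finset.sum_add_distrib] at h
  rw [h0, sum_quadraticChar_mul_canonicalAddChar p u hu] at h
  linear_combination h

theorem two_mul_gaussPeriod_zero (hK : Fintype.card K % 4 = 1) :
    2 * gaussPeriod p α 2 (0 : K) = (Fintype.card K : ℂ) - 1 := by
  have h := two_mul_gaussPeriod_add_one p hα (0 : K)
  have h0 : ((∑ z : K, quadraticChar K z : ℤ) : ℂ) = 0 := by
    rw [quadraticChar_sum_zero (ringChar_ne_two_of_card_mod_four hK), Int.cast_zero]
  push_cast at h0
  simp only [mul_zero, AddChar.map_zero_eq_one, mul_one, Finset.sum_add_distrib, h0,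
    Finset.sum_const, Finset.card_univ, nsmul_eq_mul, add_zero] at h
  linear_combination h

/-- The period `η_u` depends only on whether `u` is zero, a square or a non-square. -/
theorem two_mul_gaussPeriod (hK : Fintype.card K % 4 = 1) (u : K) :
    2 * gaussPeriod p α 2 u =
      (if u = 0 then (Fintype.card K : ℂ) - 1 else -1) +
        (quadraticChar K u : ℂ) * quadraticGaussSum p K := by
  split_ifs with hu
  · rw [hu, two_mul_gaussPeriod_zero p hα hK, quadraticChar_zero]
    simp
  · exact two_mul_gaussPeriod_of_ne_zero p hα hu

theorem gaussPeriod_congr (hK : Fintype.card K % 4 = 1) {u v : K} (h0 : u = 0 ↔ v = 0)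
    (h : quadraticChar K u = quadraticChar K v) :
    gaussPeriod p α 2 u = gaussPeriod p α 2 v := by
  have h1 := two_mul_gaussPeriod p hα hK u
  have h2 := two_mul_gaussPeriod p hα hK v
  rw [h] at h1
  simp only [h0] at h1
  exact mul_left_cancel₀ two_ne_zero (h1.trans h2.symm)

end Periods

/-! ### Sums along a group homomorphism -/

section Fibers

/-- All fibres over the range have the size of the kernel. Multiplying by the orders of the groups
avoids dividing in `R`. -/
theorem sum_comp_hom_mul_card {G H R : Type*} [Group G] [Group H] [Fintype G] [Fintype H]
    [DecidableEq H] [Field R] (φ : G →* H) (S : Subgroup H)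
    [DecidablePred (· ∈ S)] (hS : φ.range = S) (f : H → R) :
    (Nat.card S : R) * ∑ x : G, f (φ x) = Nat.card G * ∑ z : H with z ∈ S, f z := by
  have hfib : ∀ z ∈ S, (Finset.univ.filter (fun x => φ x = z)).card =
      (Finset.univ.filter (fun x => φ x = 1)).card := by
    intro z hz
    apply MonoidHom.card_fiber_eq_of_mem_range φ
    · rw [← hS] at hz
      exact hz
    · exact ⟨1, map_one φ⟩
  set c := (Finset.univ.filter (fun x => φ x = 1)).card
  have hsum : ∀ F : H → R, ∑ x : G, F (φ x) = c * ∑ z : H with z ∈ S, F z := by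
    intro F
    rw [← Finset.sum_fiberwise_of_maps_to (s := Finset.univ)
      (t := Finset.univ.filter (fun z => z ∈ S)) (g := φ)
      (fun x _ => by simp [← hS]), Finset.mul_sum]
    refine Finset.sum_congr rfl fun z hz => ?_
    have : ∀ x ∈ Finset.univ.filter (fun x => φ x = z), F (φ x) = F z := by
      intro x hx
      rw [(Finset.mem_filter.1 hx).2]
    rw [Finset.sum_congr rfl this, Finset.sum_const, nsmul_eq_mul,
      hfib z (Finset.mem_filter.1 hz).2]
  have h1 : (Nat.card G : R) = c * Nat.card S := by
    have := hsum (fun _ => 1)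
    simp only [Finset.sum_const, nsmul_eq_mul, mul_one, Finset.card_univ] at this
    rw [Nat.card_eq_fintype_card, this, Nat.card_eq_fintype_card, Fintype.card_subtype]
  rw [hsum f, h1]
  ring

theorem sum_range_four_mul {R : Type*} [AddCommMonoid R] (f : ℕ → R) (M : ℕ) :
    ∑ i ∈ Finset.range (4 * M), f i =
      ∑ j ∈ Finset.range M, (f (4 * j) + f (4 * j + 1) + f (4 * j + 2) + f (4 * j + 3)) := by
  induction M with
  | zero => simp
  | succ M ih =>
    rw [Finset.sum_range_succ, ← ih, mul_add, mul_one]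
    simp only [Finset.sum_range_succ]
    simp only [← add_assoc]

end Fibers

/-! ### Consequences of the divisibility and gcd conditions -/

section Arithmetic

variable {F K : Type*} [Field F] [Fintype F] [Field K] [Fintype K] [Algebra F K]

/-- The number `(r - 1) / (q - 1) = 1 + q + ⋯ + q ^ (m - 1)`. -/
noncomputable def geomSum (F K : Type*) [Field F] [Fintype F] [Field K] [Algebra F K] : ℕ :=
  ∑ i ∈ Finset.range (Module.finrank F K), Fintype.card F ^ i

theorem card_sub_one_mul_geomSum :
    (Fintype.card F - 1) * geomSum F K = Fintype.card K - 1 := by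
  rw [Module.card_eq_pow_finrank (K := F) (V := K), geomSum]
  have h1 : 1 ≤ Fintype.card F := Fintype.card_pos
  zify [h1, Nat.one_le_pow (Module.finrank F K) _ h1]
  rw [mul_comm]
  exact geom_sum_mul _ _

omit [Fintype K] in
-- Since `q ≡ 1` modulo `q - 1`, the sum may be replaced by `m` in gcds with divisors of `q - 1`;
-- this is how the condition on `m` enters.
theorem geomSum_modEq : geomSum F K ≡ Module.finrank F K [MOD Fintype.card F - 1] := by
  have h1 : 1 ≤ Fintype.card F := Fintype.card_pos
  have h2 : Fintype.card F ≡ 1 [MOD Fintype.card F - 1] :=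
    ((Nat.modEq_iff_dvd' h1).2 dvd_rfl).symm
  have h3 := Nat.ModEq.sum (s := Finset.range (Module.finrank F K))
    (f := fun i => Fintype.card F ^ i) (g := fun _ => 1) (n := Fintype.card F - 1)
    (fun i _ => by simpa using h2.pow i)
  simpa [geomSum] using h3

/-- The standing hypotheses on `q`, `m` and `h`. -/
structure Admissible (F K : Type*) [Field F] [Fintype F] [Field K] [Algebra F K] (h : ℕ) :
    Prop where
  four_dvd : 4 ∣ h
  dvd : h ∣ Fintype.card F - 1
  gcd : Nat.gcd (Module.finrank F K) (4 * (Fintype.card F - 1) / h) = 2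

variable {h : ℕ} (H : Admissible F K h)
include H

omit [Fintype K] in
theorem Admissible.pos : 0 < h := by
  rcases Nat.eq_zero_or_pos h with h0 | h0
  · have h1 := H.dvd
    have h2 : 1 < Fintype.card F := Fintype.one_lt_card
    rw [h0, zero_dvd_iff] at h1
    omega
  · exact h0

omit [Fintype K] in
theorem Admissible.four_dvd_card_sub_one : 4 ∣ Fintype.card F - 1 := H.four_dvd.trans H.dvd

omit [Fintype K] in
theorem Admissible.four_mul_div : 4 * (Fintype.card F - 1) / h = 4 * ((Fintype.card F - 1) / h) :=
  Nat.mul_div_assoc _ H.dvd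

omit [Fintype K] in
theorem Admissible.even_finrank : 2 ∣ Module.finrank F K := by
  have := Nat.gcd_dvd_left (Module.finrank F K) (4 * (Fintype.card F - 1) / h)
  rwa [H.gcd] at this

omit [Fintype K] in
theorem Admissible.even_geomSum : 2 ∣ geomSum F K := by
  have h1 := (geomSum_modEq (F := F) (K := K)).of_dvd
    ((by norm_num : 2 ∣ 4).trans H.four_dvd_card_sub_one)
  exact (h1.dvd_iff dvd_rfl).2 H.even_finrank

omit [Fintype K] in
theorem Admissible.finrank_pos : 0 < Module.finrank F K := by
  rcases Nat.eq_zero_or_pos (Module.finrank F K) with h0 | h0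
  · have h1 := H.gcd
    rw [h0, Nat.gcd_zero_left, H.four_mul_div] at h1
    omega
  · exact h0

theorem Admissible.card_mod_eight : Fintype.card K % 8 = 1 := by
  obtain ⟨s, hs⟩ := H.four_dvd_card_sub_one
  obtain ⟨t, ht⟩ := H.even_geomSum
  have h1 := card_sub_one_mul_geomSum (F := F) (K := K)
  rw [hs, ht] at h1
  have h2 : 1 < Fintype.card K := Fintype.one_lt_card
  have h3 : 4 * s * (2 * t) = 8 * (s * t) := by ring
  omega

theorem Admissible.card_mod_four : Fintype.card K % 4 = 1 := by
  have := H.card_mod_eight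
  omega

/-- `(r - 1)/(q - 1)` is even, so the Euler exponent `(r - 1)/2` is a multiple of `q - 1`. -/
theorem Admissible.isSquare_algebraMap (y : F) : IsSquare (algebraMap F K y) := by
  by_cases hy : y = 0
  · rw [hy, map_zero]
    exact ⟨0, by simp⟩
  rw [FiniteField.isSquare_iff (ringChar_ne_two_of_card_mod_four H.card_mod_four)
    (by simpa using hy)]
  obtain ⟨t, ht⟩ := H.even_geomSum
  have h1 := card_sub_one_mul_geomSum (F := F) (K := K)
  have h2 := H.card_mod_four
  have h3 : Fintype.card K / 2 = (Fintype.card F - 1) * t := by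
    rw [ht] at h1
    have : (Fintype.card F - 1) * (2 * t) = 2 * ((Fintype.card F - 1) * t) := by ring
    omega
  rw [h3, pow_mul, ← map_pow, FiniteField.pow_card_sub_one_eq_one y hy, map_one, one_pow]

variable {α : Kˣ} (hα : ∀ x : Kˣ, x ∈ Subgroup.zpowers α)

omit H in
theorem exists_algebraMap_eq_pow_geomSum (x : K) :
    ∃ y : F, algebraMap F K y = x ^ geomSum F K := by
  refine ⟨Algebra.norm F x, ?_⟩
  rw [FiniteField.algebraMap_norm_eq_pow_sum, geomSum, Nat.card_eq_fintype_card]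

/-- The multiplication map from `⟨g ^ 4⟩ × GF(q)^*` to `GF(r)^*`. -/
noncomputable def mulHom (F : Type*) [Field F] [Algebra F K] (γ : Kˣ) :
    Subgroup.zpowers γ × Fˣ →* Kˣ :=
  (Subgroup.zpowers γ).subtype.coprod (Units.map (algebraMap F K).toMonoidHom)

include hα in
-- Both factors consist of squares. Conversely, with `d = 4(q - 1)/h` and `N = (r - 1)/(q - 1)`, the
-- image contains `α^d` and `α^N` (the norm of `α`, which lies in `F`), and `gcd(N, d) = gcd(m, d) =
-- 2`; Bézout yields `α²`.
theorem Admissible.range_mulHom :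
    (mulHom F (α ^ (4 * ((Fintype.card F - 1) / h)))).range = Subgroup.zpowers (α ^ 2) := by
  set d := 4 * ((Fintype.card F - 1) / h) with hd
  have hgcd := H.gcd
  rw [H.four_mul_div, ← hd] at hgcd
  apply le_antisymm
  · rintro _ ⟨⟨⟨_, k, rfl⟩, y⟩, rfl⟩
    rw [mem_zpowers_sq_iff_isSquare hα]
    have h1 : ((mulHom F (α ^ d)) (⟨(α ^ d) ^ k, ⟨k, rfl⟩⟩, y) : K) =
        (((α ^ d) ^ k : Kˣ) : K) * algebraMap F K y := rfl
    refine h1 ▸ IsSquare.mul ?_ (H.isSquare_algebraMap _)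
    refine ⟨(((α ^ (2 * ((Fintype.card F - 1) / h))) ^ k : Kˣ) : K), ?_⟩
    rw [← Units.val_mul, ← mul_zpow, ← pow_add]
    congr 3
    omega
  · rw [Subgroup.zpowers_le]
    have m1 : α ^ d ∈ (mulHom F (α ^ d)).range := by
      refine ⟨(⟨α ^ d, Subgroup.mem_zpowers _⟩, 1), ?_⟩
      simp [mulHom]
    have m2 : α ^ geomSum F K ∈ (mulHom F (α ^ d)).range := by
      obtain ⟨y, hy⟩ := exists_algebraMap_eq_pow_geomSum (F := F) (α : K)
      have hy0 : y ≠ 0 := by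
        rintro rfl
        rw [map_zero] at hy
        exact pow_ne_zero _ α.ne_zero hy.symm
      refine ⟨(1, Units.mk0 y hy0), ?_⟩
      apply Units.ext
      simp [mulHom, hy]
    have hdvd : d ∣ Fintype.card F - 1 := by
      obtain ⟨t, ht⟩ := H.four_dvd
      obtain ⟨s, hs⟩ := H.dvd
      refine ⟨t, ?_⟩
      rw [hd, hs, Nat.mul_div_cancel_left _ H.pos, ht]
      ring
    have hN : Nat.gcd (geomSum F K) d = 2 := by
      rw [← hgcd]
      exact ((geomSum_modEq (F := F) (K := K)).of_dvd hdvd).gcd_eq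
    have hbez := Nat.gcd_eq_gcd_ab (geomSum F K) d
    rw [hN] at hbez
    have : α ^ 2 = (α ^ geomSum F K) ^ (Nat.gcdA (geomSum F K) d) *
        (α ^ d) ^ (Nat.gcdB (geomSum F K) d) := by
      rw [← zpow_natCast, hbez, zpow_add, zpow_mul, zpow_mul, zpow_natCast, zpow_natCast]
    rw [this]
    exact Subgroup.mul_mem _ (Subgroup.zpow_mem _ m2 _) (Subgroup.zpow_mem _ m1 _)

include hα in
omit H in
theorem orderOf_generator : orderOf α = Fintype.card K - 1 := by
  classical
  rw [orderOf_eq_card_of_forall_mem_zpowers hα, Nat.card_eq_fintype_card, Fintype.card_units]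

include hα in
-- The order of `g^4` is `n / 4`, so along one residue class of coordinates modulo 4 the powers of
-- `g^4` run through `⟨g^4⟩` exactly once.
theorem Admissible.orderOf_pow :
    orderOf (α ^ (4 * ((Fintype.card F - 1) / h))) = h / 4 * geomSum F K := by
  obtain ⟨t, ht⟩ := H.four_dvd
  obtain ⟨s, hs⟩ := H.dvd
  have hpos := H.pos
  have hq : 1 < Fintype.card F := Fintype.one_lt_card
  have hs0 : 0 < s := by
    rcases Nat.eq_zero_or_pos s with h0 | h0
    · rw [h0, mul_zero] at hs
      omega
    · exact h0
  have e1 : (Fintype.card F - 1) / h = s := by rw [hs, Nat.mul_div_cancel_left _ hpos]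
  have e2 : h / 4 = t := by omega
  have h1 := card_sub_one_mul_geomSum (F := F) (K := K)
  have h2 : Fintype.card K - 1 = 4 * s * (t * geomSum F K) := by
    rw [← h1, hs, ht]
    ring
  rw [e1, e2, _root_.orderOf_pow, orderOf_generator hα, h2, Nat.gcd_mul_right_left,
    Nat.mul_div_cancel_left _ (by omega)]

include hα in
theorem Admissible.card_zpowers_sq :
    Nat.card (Subgroup.zpowers (α ^ 2)) = (Fintype.card K - 1) / 2 := by
  rw [Nat.card_zpowers, _root_.orderOf_pow, orderOf_generator hα]
  have := H.card_mod_four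
  have h2 : Nat.gcd (Fintype.card K - 1) 2 = 2 := Nat.gcd_eq_right (by omega)
  rw [h2]

omit H in
theorem codeLength_eq : codeLength F K h = h * geomSum F K := by
  have hq : 1 < Fintype.card F := Fintype.one_lt_card
  rw [codeLength, ← card_sub_one_mul_geomSum (F := F), mul_left_comm,
    Nat.mul_div_cancel_left _ (by omega)]

end Arithmetic

/-! ### Hamming weights through Gauss periods -/

section Weights

variable {p : ℕ} [Fact p.Prime] {F K : Type*} [Field F] [Fintype F] [DecidableEq F]
  [Field K] [Fintype K] [Algebra F K] [Algebra (ZMod p) K]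

variable (p) in
-- By transitivity and `F`-linearity of the trace, `ψ_K(y x) = ψ_F(y Tr x)`; then orthogonality on
-- `F` applies.
theorem sum_canonicalAddChar_algebraMap_mul (x : K) :
    ∑ y : F, canonicalAddChar p K (algebraMap F K y * x) =
      if Algebra.trace F K x = 0 then (Fintype.card F : ℂ) else 0 := by
  have hK : CharP K p := charP_of_injective_algebraMap (algebraMap (ZMod p) K).injective p
  have hF : CharP F p := (RingHom.charP_iff _ (algebraMap F K).injective p).2 hK
  let _ : Algebra (ZMod p) F := ZMod.algebra F p
  have : IsScalarTower (ZMod p) F K := IsScalarTower.of_algebraMap_eq' (RingHom.ext_zmod _ _)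
  have h1 : ∀ y : F, canonicalAddChar p K (algebraMap F K y * x) =
      canonicalAddChar p F (y * Algebra.trace F K x) := by
    intro y
    rw [canonicalAddChar_apply, canonicalAddChar_apply, canonicalChar, canonicalChar,
      ← Algebra.trace_trace (S := F), ← Algebra.smul_def, map_smul, smul_eq_mul]
  rw [Finset.sum_congr rfl fun y _ => h1 y,
    AddChar.sum_mulShift _ (canonicalAddChar_isPrimitive p F)]
  push_cast
  rfl

theorem sum_units_eq_sum_sub {f : F → ℂ} : ∑ y : Fˣ, f y = ∑ y : F, f y - f 0 := by
  classical
  rw [← Finset.sum_sdiff (Finset.subset_univ ({0} : Finset F)), Finset.sum_singleton,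
    add_sub_cancel_right]
  refine Finset.sum_bij (fun u _ => (u : F)) (by simp) (fun a _ b _ h => Units.ext h) ?_
    (fun _ _ => rfl)
  intro b hb
  have hb' : b ≠ 0 := by simpa using hb
  exact ⟨Units.mk0 b hb', by simp, rfl⟩

variable {h : ℕ} (H : Admissible F K h) {α : Kˣ} (hα : ∀ x : Kˣ, x ∈ Subgroup.zpowers α)
include H hα

variable (p) in
/-- Every nonzero square is hit `h / 2` times by `⟨g ^ 4⟩ × GF(q)^*`. -/
theorem Admissible.sum_sum_units (v : K) :
    ∑ j ∈ Finset.range (h / 4 * geomSum F K), ∑ y : Fˣ,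
      canonicalAddChar p K (algebraMap F K y * (gElt F α h ^ (4 * j) * v)) =
      h / 2 * gaussPeriod p α 2 v := by
  classical
  set γ := α ^ (4 * ((Fintype.card F - 1) / h)) with hγ
  have hfin : IsOfFinOrder γ := isOfFinOrder_of_finite γ
  have h1 : ∑ j ∈ Finset.range (h / 4 * geomSum F K), ∑ y : Fˣ,
      canonicalAddChar p K (algebraMap F K y * (gElt F α h ^ (4 * j) * v)) =
      ∑ x : Subgroup.zpowers γ × Fˣ, canonicalAddChar p K ((mulHom F γ x : K) * v) := by
    rw [Fintype.sum_prod_type, ← H.orderOf_pow hα, ← hγ, Finset.sum_range,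
      ← Equiv.sum_comp (finEquivZPowers hfin)]
    refine Finset.sum_congr rfl fun j _ => Finset.sum_congr rfl fun y _ => ?_
    congr 1
    have : (mulHom F γ ((finEquivZPowers hfin) j, y) : K) =
        ((γ ^ (j : ℕ) : Kˣ) : K) * algebraMap F K y := rfl
    have hpow : ((γ ^ (j : ℕ) : Kˣ) : K) = gElt F α h ^ (4 * (j : ℕ)) := by
      simp only [hγ, gElt, Units.val_pow_eq_pow_val, ← pow_mul]
      ring
    rw [this, hpow]
    ring
  have h2 := sum_comp_hom_mul_card (mulHom F γ) _ (H.range_mulHom hα)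
    (fun z : Kˣ => canonicalAddChar p K ((z : K) * v))
  have h3 : gaussPeriod p α 2 v =
      ∑ z : Kˣ with z ∈ Subgroup.zpowers (α ^ 2), canonicalAddChar p K ((z : K) * v) := by
    rw [gaussPeriod]
    refine Finset.sum_congr (Finset.ext fun _ => by simp) fun _ _ => rfl
  rw [h1, h3]
  have hcard : Nat.card (Subgroup.zpowers γ × Fˣ) = h / 4 * (Fintype.card K - 1) := by
    rw [Nat.card_prod, Nat.card_zpowers, H.orderOf_pow hα, Nat.card_eq_fintype_card,
      Fintype.card_units, mul_assoc, mul_comm (geomSum F K), card_sub_one_mul_geomSum]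
  rw [hcard, H.card_zpowers_sq hα] at h2
  have hc := H.card_mod_four
  obtain ⟨t, ht⟩ := H.four_dvd
  have hK1 : 1 < Fintype.card K := Fintype.one_lt_card
  obtain ⟨w, hw⟩ : ∃ w, Fintype.card K = 4 * w + 1 := ⟨Fintype.card K / 4, by omega⟩
  have e1 : (Fintype.card K - 1) / 2 = 2 * w := by omega
  have e2 : h / 4 * (Fintype.card K - 1) = 2 * w * (2 * t) := by
    rw [ht, Nat.mul_div_cancel_left _ (by norm_num), hw, Nat.add_sub_cancel]
    ring
  have e3 : (h : ℂ) / 2 = (2 * t : ℕ) := by rw [ht]; push_cast; ring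
  have hw0 : ((2 * w : ℕ) : ℂ) ≠ 0 := by
    rw [Nat.cast_ne_zero]; omega
  rw [e1, e2] at h2
  rw [e3]
  apply mul_left_cancel₀ hw0
  rw [h2]
  push_cast
  ring

omit H in
theorem betaElt_pow_four (hK : Fintype.card K % 4 = 1) : betaElt α 4 ^ 4 = 1 := by
  rw [betaElt, ← pow_mul, Nat.div_mul_cancel (by omega), ← orderOf_generator hα,
    ← Units.val_pow_eq_pow_val, pow_orderOf_eq_one, Units.val_one]

omit [Field F] [DecidableEq F] [Fintype K] [Algebra F K] H hα in
theorem isSquare_gElt_pow_four : IsSquare (gElt F α h ^ 4) :=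
  ⟨gElt F α h ^ 2, by ring⟩

/-- The Hamming weight of a codeword in terms of the modified weight. -/
theorem Admissible.hammingNorm_codeword (a b : K) :
    (hammingNorm (codeword F α h 4 a b) : ℂ) =
      codeLength F K h -
        h * ((Fintype.card K : ℂ) - 1) / (Fintype.card F * ((Fintype.card F : ℂ) - 1)) -
        modifiedWeight p F α h 4 2 a b := by
  classical
  have hK4 := H.card_mod_four
  have hβ := betaElt_pow_four hα hK4
  set N := geomSum F K with hN
  set β := betaElt α 4 with hβ'
  set g := gElt F α h with hg
  obtain ⟨t, ht⟩ := H.four_dvd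
  have hq : 1 < Fintype.card F := Fintype.one_lt_card
  have hq0 : (Fintype.card F : ℂ) ≠ 0 := by rw [Nat.cast_ne_zero]; omega
  have hq1 : (Fintype.card F : ℂ) - 1 ≠ 0 := by
    rw [sub_ne_zero]; exact_mod_cast hq.ne'
  have hr : (Fintype.card K : ℂ) - 1 = (Fintype.card F - 1) * N := by
    have h1 := card_sub_one_mul_geomSum (F := F) (K := K)
    have h2 := congrArg (Nat.cast : ℕ → ℂ) h1
    rw [Nat.cast_mul, Nat.cast_sub hq.le, Nat.cast_sub Fintype.card_pos] at h2
    rw [hN, ← Nat.cast_one (R := ℂ), h2]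
  let x : ℕ → K := fun i => (a + β ^ i * b) * g ^ i
  have hx : ∀ i, a * g ^ i + b * (β * g) ^ i = x i := fun i => by
    simp only [x, mul_pow]
    ring
  have hlen : codeLength F K h = 4 * (h / 4 * N) := by
    rw [codeLength_eq, ht, Nat.mul_div_cancel_left _ (by norm_num), mul_assoc]
  have hweight : (hammingNorm (codeword F α h 4 a b) : ℂ) = codeLength F K h -
      ∑ i ∈ Finset.range (codeLength F K h),
        if Algebra.trace F K (x i) = 0 then (1 : ℂ) else 0 := by
    rw [Finset.sum_range, hammingNorm, Finset.card_filter]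
    push_cast
    rw [eq_sub_iff_add_eq, ← Finset.sum_add_distrib]
    have : ∀ i : Fin (codeLength F K h), ((if codeword F α h 4 a b i ≠ 0 then (1 : ℂ) else 0) +
        if Algebra.trace F K (x i) = 0 then (1 : ℂ) else 0) = 1 := by
      intro i
      have hc : codeword F α h 4 a b i = Algebra.trace F K (x i) := by
        rw [← hx]
        rfl
      rw [hc]
      by_cases h0 : Algebra.trace F K (x i) = 0 <;> simp [h0]
    rw [Finset.sum_congr rfl fun i _ => this i]
    simp
  -- The summand 1 is the contribution of `y = 0`; only units are left, matching the group `⟨g^4⟩ ×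
  -- F^*`.
  have hq' : ∀ i, (Fintype.card F : ℂ) * (if Algebra.trace F K (x i) = 0 then (1 : ℂ) else 0) =
      1 + ∑ y : Fˣ, canonicalAddChar p K (algebraMap F K y * x i) := by
    intro i
    rw [sum_units_eq_sum_sub (f := fun y => canonicalAddChar p K (algebraMap F K y * x i)),
      sum_canonicalAddChar_algebraMap_mul p (x i), map_zero, zero_mul, AddChar.map_zero_eq_one]
    split_ifs <;> ring
  have hS : ∑ i ∈ Finset.range (codeLength F K h), ∑ y : Fˣ,
      canonicalAddChar p K (algebraMap F K y * x i) =
      h / 2 * ∑ i ∈ Finset.Icc 1 4, gaussPeriod p α 2 (x i) := by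
    have hper : ∀ j k, x (4 * j + k) = g ^ (4 * j) * x k := by
      intro j k
      simp only [x]
      rw [pow_add, pow_mul, hβ, one_pow, one_mul, pow_add]
      ring
    -- Coordinates give the residues 0 to 3 while `λ` sums over 1 to 4. The two agree because `x 4`
    -- and `x 0` differ by the square `g^4`.
    have h4 : gaussPeriod p α 2 (x 4) = gaussPeriod p α 2 (x 0) := by
      have hx4 : x 4 = g ^ 4 * x 0 := hper 1 0
      have hg0 : g ^ 4 ≠ 0 := pow_ne_zero _ (pow_ne_zero _ α.ne_zero)
      apply gaussPeriod_congr p hα hK4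
      · rw [hx4]
        simp [hg0]
      · rw [hx4, map_mul, (quadraticChar_one_iff_isSquare hg0).2 (isSquare_gElt_pow_four),
          one_mul]
    rw [hlen, sum_range_four_mul]
    simp only [Finset.sum_add_distrib]
    have hk : ∀ k, ∑ j ∈ Finset.range (h / 4 * N), ∑ y : Fˣ,
        canonicalAddChar p K (algebraMap F K y * x (4 * j + k)) =
        h / 2 * gaussPeriod p α 2 (x k) := by
      intro k
      rw [← H.sum_sum_units p hα (x k)]
      simp only [hper]
      rfl
    have hk0 := hk 0
    simp only [add_zero] at hk0
    rw [hk0, hk 1, hk 2, hk 3, Finset.sum_Icc_succ_top (by norm_num),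
      Finset.sum_Icc_succ_top (by norm_num), Finset.sum_Icc_succ_top (by norm_num),
      Finset.Icc_self, Finset.sum_singleton]
    norm_num only
    rw [h4]
    ring
  have hZ : (Fintype.card F : ℂ) * ∑ i ∈ Finset.range (codeLength F K h),
      (if Algebra.trace F K (x i) = 0 then (1 : ℂ) else 0) =
      codeLength F K h + h / 2 * ∑ i ∈ Finset.Icc 1 4, gaussPeriod p α 2 (x i) := by
    rw [Finset.mul_sum, Finset.sum_congr rfl fun i _ => hq' i, Finset.sum_add_distrib, hS]
    simp
  have hlenC : (codeLength F K h : ℂ) = h * N := by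
    rw [codeLength_eq]
    push_cast
    rfl
  rw [hlenC] at hZ
  rw [hweight, hr, modifiedWeight, hlenC, sub_sub, sub_right_inj]
  apply mul_left_cancel₀ hq0
  rw [hZ, mul_add]
  simp only [x, hβ', hg]
  field_simp
  push_cast
  ring_nf

end Weights

/-! ### Character sums over the plane `K × K` -/

section LinearForms

variable {K : Type*} [Field K] [Fintype K] [DecidableEq K]

/-- The two linear forms are independent, so after a translation of `a` the variable `b` occurs in
one factor only, where `χ` sums to zero. -/
theorem sum_sum_quadraticChar_mul (hK : ringChar K ≠ 2) {u v : K} (huv : u ≠ v) :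
    ∑ ab : K × K, quadraticChar K (ab.1 + u * ab.2) * quadraticChar K (ab.1 + v * ab.2) = 0 := by
  rw [Fintype.sum_prod_type_right]
  have h1 : ∀ b : K, ∑ a : K, quadraticChar K (a + u * b) * quadraticChar K (a + v * b) =
      ∑ a : K, quadraticChar K a * quadraticChar K (a + (v - u) * b) := by
    intro b
    rw [← Equiv.sum_comp (Equiv.addRight (u * b))
      (fun a => quadraticChar K a * quadraticChar K (a + (v - u) * b))]
    refine Finset.sum_congr rfl fun a _ => ?_
    rw [Equiv.coe_addRight]
    congr 2
    ring
  simp only [h1]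
  rw [Finset.sum_comm]
  refine Finset.sum_eq_zero fun a _ => ?_
  rw [← Finset.mul_sum]
  have h2 : ∑ b : K, quadraticChar K (a + (v - u) * b) = 0 := by
    have hvu : v - u ≠ 0 := sub_ne_zero.2 huv.symm
    rw [← quadraticChar_sum_zero hK,
      ← Equiv.sum_comp ((Equiv.mulLeft₀ (v - u) hvu).trans (Equiv.addLeft a)) (quadraticChar K)]
    rfl
  rw [h2, mul_zero]

/-- Scaling `a` by `b` removes `b ≠ 0` up to a square factor; `b = 0` adds `r - 1`. -/
theorem sum_quadraticChar_pow_four_sub_pow_four :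
    ∑ ab : K × K, quadraticChar K (ab.1 ^ 4 - ab.2 ^ 4) =
      ((Fintype.card K : ℤ) - 1) * (∑ a : K, quadraticChar K (a ^ 4 - 1) + 1) := by
  rw [Fintype.sum_prod_type_right]
  simp only
  rw [← Finset.sum_sdiff (Finset.subset_univ ({0} : Finset K)), Finset.sum_singleton]
  have h0 : ∑ a : K, quadraticChar K (a ^ 4 - 0 ^ 4) = (Fintype.card K : ℤ) - 1 := by
    rw [← Finset.sum_sdiff (Finset.subset_univ ({0} : Finset K)), Finset.sum_singleton]
    have h1 : ∀ a ∈ Finset.univ \ ({0} : Finset K), quadraticChar K (a ^ 4 - 0 ^ 4) = 1 := by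
      intro a ha
      have ha0 : a ≠ 0 := by simpa using ha
      rw [zero_pow (by norm_num), sub_zero, show a ^ 4 = (a ^ 2) ^ 2 by ring,
        quadraticChar_sq_one' (pow_ne_zero 2 ha0)]
    rw [Finset.sum_congr rfl h1, Finset.sum_const,
      Finset.card_sdiff_of_subset (Finset.subset_univ _)]
    have : 1 ≤ Fintype.card K := Fintype.card_pos
    simp [this]
  have hb : ∀ b ∈ Finset.univ \ ({0} : Finset K),
      ∑ a : K, quadraticChar K (a ^ 4 - b ^ 4) = ∑ a : K, quadraticChar K (a ^ 4 - 1) := by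
    intro b hb
    have hb0 : b ≠ 0 := by simpa using hb
    rw [← Equiv.sum_comp (Equiv.mulLeft₀ b hb0)]
    refine Finset.sum_congr rfl fun a _ => ?_
    rw [Equiv.mulLeft₀_apply, show (b * a) ^ 4 - b ^ 4 = (b ^ 2) ^ 2 * (a ^ 4 - 1) by ring, map_mul,
      quadraticChar_sq_one' (pow_ne_zero 2 hb0), one_mul]
  rw [Finset.sum_congr rfl hb, Finset.sum_const, h0,
    Finset.card_sdiff_of_subset (Finset.subset_univ _)]
  have : 1 ≤ Fintype.card K := Fintype.card_pos
  simp [this]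
  ring

omit [DecidableEq K] in
theorem sum_eq_zero_of_scaling {f : K × K → ℤ} {c : K} (hc : c ≠ 0)
    (hf : ∀ ab, f (c * ab.1, c * ab.2) = -f ab) : ∑ ab : K × K, f ab = 0 := by
  have h1 : ∑ ab : K × K, f ab = -∑ ab : K × K, f ab := by
    rw [← Finset.sum_neg_distrib,
      ← Equiv.sum_comp (Equiv.prodCongr (Equiv.mulLeft₀ c hc) (Equiv.mulLeft₀ c hc)) f]
    exact Finset.sum_congr rfl fun ab _ => hf ab
  omega

end LinearForms

/-! ### The four lines `a + β^t b = 0` and their complement -/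

section PairSums

variable {K : Type*} [Field K] [Fintype K] [DecidableEq K]

/-- The facts about a primitive fourth root of unity used in the counting. -/
structure IsFourthRoot (β : K) : Prop where
  sq : β ^ 2 = -1
  isSquare_sub : ∀ i j : ℕ, IsSquare (β ^ i - β ^ j)
  char : ringChar K ≠ 2

variable {β : K} (hβ : IsFourthRoot β)
include hβ

omit [Fintype K] [DecidableEq K] in
theorem IsFourthRoot.pow_four : β ^ 4 = 1 := by linear_combination (β ^ 2 - 1) * hβ.sq

omit [Fintype K] [DecidableEq K] in
theorem IsFourthRoot.pow_injOn : Set.InjOn (fun t => β ^ t) (Finset.Icc 1 4 : Finset ℕ) := by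
  have h4 : orderOf β = 4 := by
    refine orderOf_eq_prime_pow (p := 2) (n := 1) ?_ (by simpa using hβ.pow_four)
    rw [pow_one, hβ.sq]
    exact Ring.neg_one_ne_one_of_char_ne_two hβ.char
  intro i hi j hj hij
  simp only at hij
  have hb : β ≠ 0 := by
    rintro rfl
    have := hβ.pow_four
    simp at this
  rw [← Units.val_mk0 hb, orderOf_units] at h4
  have hij' : Units.mk0 β hb ^ i = Units.mk0 β hb ^ j := Units.ext (by simpa using hij)
  rw [pow_inj_mod, h4] at hij'
  simp only [Finset.coe_Icc, Set.mem_Icc] at hi hj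
  omega

theorem IsFourthRoot.quadraticChar_sub {i j : ℕ} (hi : i ∈ Finset.Icc 1 4)
    (hj : j ∈ Finset.Icc 1 4) (hij : i ≠ j) : quadraticChar K (β ^ i - β ^ j) = 1 := by
  rw [quadraticChar_one_iff_isSquare]
  · exact hβ.isSquare_sub i j
  · rw [sub_ne_zero]
    exact fun h => hij (hβ.pow_injOn hi hj h)

omit [Fintype K] [DecidableEq K] in
theorem IsFourthRoot.prod_eq (a b : K) :
    ∏ i ∈ Finset.Icc 1 4, (a + β ^ i * b) = a ^ 4 - b ^ 4 := by
  rw [Finset.prod_Icc_succ_top (by norm_num), Finset.prod_Icc_succ_top (by norm_num),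
      Finset.prod_Icc_succ_top (by norm_num), Finset.Icc_self, Finset.prod_singleton]
  norm_num only
  have h3 : β ^ 3 = -β := by linear_combination β * hβ.sq
  rw [hβ.pow_four, h3, hβ.sq, pow_one]
  linear_combination (b ^ 4 - a ^ 2 * b ^ 2) * hβ.sq

/-- The nonzero pairs on one of the four lines. -/
def lineFinset (K : Type*) [Field K] [Fintype K] [DecidableEq K] : Finset (K × K) :=
  Finset.univ.filter fun ab => ab ≠ (0, 0) ∧ ab.1 ^ 4 - ab.2 ^ 4 = 0

/-- The pairs off the four lines. -/
def offLineFinset (K : Type*) [Field K] [Fintype K] [DecidableEq K] : Finset (K × K) :=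
  Finset.univ.filter fun ab => ab.1 ^ 4 - ab.2 ^ 4 ≠ 0

omit hβ in
theorem sum_univ_eq (f : K × K → ℤ) :
    ∑ ab, f ab = f (0, 0) + ∑ ab ∈ lineFinset K, f ab + ∑ ab ∈ offLineFinset K, f ab := by
  rw [← Finset.sum_filter_add_sum_filter_not Finset.univ
    (fun ab : K × K => ab.1 ^ 4 - ab.2 ^ 4 = 0) f]
  congr 1
  have : Finset.univ.filter (fun ab : K × K => ab.1 ^ 4 - ab.2 ^ 4 = 0) =
      insert (0, 0) (lineFinset K) := by
    ext ab
    by_cases h : ab = (0, 0)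
    · simp [lineFinset, h]
    · simp [lineFinset, h]
  rw [this, Finset.sum_insert (by simp [lineFinset])]

/-- The powers `β^t` are distinct, so the lines meet only at the origin, and `b ≠ 0` parametrizes
each of them. -/
theorem IsFourthRoot.sum_line (f : K × K → ℤ) :
    ∑ ab ∈ lineFinset K, f ab =
      ∑ t ∈ Finset.Icc 1 4, ∑ b ∈ Finset.univ \ {0}, f (-(β ^ t * b), b) := by
  rw [← Finset.sum_product']
  symm
  refine Finset.sum_nbij (fun tb => (-(β ^ tb.1 * tb.2), tb.2)) ?_ ?_ ?_ (fun _ _ => rfl)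
  · rintro ⟨t, b⟩ htb
    simp only [Finset.mem_product, Finset.mem_sdiff, Finset.mem_univ, true_and,
      Finset.mem_singleton] at htb
    simp only [lineFinset, Finset.mem_filter, Finset.mem_univ, true_and]
    refine ⟨fun h => htb.2 (congrArg Prod.snd h), ?_⟩
    rw [← hβ.prod_eq]
    exact Finset.prod_eq_zero htb.1 (by ring)
  · rintro ⟨t, b⟩ h1 ⟨t', b'⟩ h2 h
    simp only [Finset.coe_product, Set.mem_prod, Finset.mem_coe, Finset.mem_sdiff,
      Finset.mem_univ, true_and, Finset.mem_singleton] at h1 h2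
    simp only [Prod.mk.injEq, neg_inj] at h
    obtain ⟨h3, rfl⟩ := h
    rw [hβ.pow_injOn h1.1 h2.1 (mul_right_cancel₀ h1.2 h3)]
  · rintro ⟨a, b⟩ hab
    simp only [lineFinset, Finset.coe_filter, Finset.mem_univ, true_and, Set.mem_ofPred_eq] at hab
    rw [← hβ.prod_eq, Finset.prod_eq_zero_iff] at hab
    obtain ⟨h0, t, ht, h1⟩ := hab
    refine ⟨(t, b), ?_, ?_⟩
    · simp only [Finset.coe_product, Set.mem_prod, Finset.mem_coe, Finset.mem_sdiff,
        Finset.mem_univ, true_and, Finset.mem_singleton]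
      refine ⟨ht, ?_⟩
      rintro rfl
      apply h0
      simpa using h1
    · simp only [Prod.mk.injEq, and_true]
      exact (eq_neg_of_add_eq_zero_left h1).symm

theorem IsFourthRoot.card_line :
    ((lineFinset K).card : ℤ) = 4 * ((Fintype.card K : ℤ) - 1) := by
  have := hβ.sum_line (fun _ => 1)
  have h1 : 1 ≤ Fintype.card K := Fintype.card_pos
  simp [Finset.card_sdiff_of_subset, h1] at this
  rw [this]
  ring

theorem IsFourthRoot.card_offLine :
    ((offLineFinset K).card : ℤ) = ((Fintype.card K : ℤ) - 1) * (Fintype.card K - 3) := by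
  have := sum_univ_eq (K := K) (fun _ => 1)
  simp only [Finset.sum_const, nsmul_eq_mul, mul_one, hβ.card_line, Finset.card_univ,
    Fintype.card_prod] at this
  push_cast at this
  linear_combination -this

/-- The sum over the whole plane is 0. Lines `i` and `j` contribute nothing; on either of the other
two the product is `χ(b)² = 1`, since differences of powers of `β` are squares. This gives `2(r -
1)` to subtract. -/
theorem IsFourthRoot.sum_offLine_mul {i j : ℕ} (hi : i ∈ Finset.Icc 1 4)
    (hj : j ∈ Finset.Icc 1 4) (hij : i ≠ j) :
    ∑ ab ∈ offLineFinset K, quadraticChar K (ab.1 + β ^ i * ab.2) *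
      quadraticChar K (ab.1 + β ^ j * ab.2) = -2 * ((Fintype.card K : ℤ) - 1) := by
  have hne : β ^ i ≠ β ^ j := fun h => hij (hβ.pow_injOn hi hj h)
  have h1 := sum_univ_eq (fun ab => quadraticChar K (ab.1 + β ^ i * ab.2) *
      quadraticChar K (ab.1 + β ^ j * ab.2))
  rw [sum_sum_quadraticChar_mul hβ.char hne, hβ.sum_line] at h1
  have h2 : ∀ t ∈ Finset.Icc 1 4, ∑ b ∈ Finset.univ \ ({0} : Finset K),
      quadraticChar K (-(β ^ t * b) + β ^ i * b) * quadraticChar K (-(β ^ t * b) + β ^ j * b) =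
      if t = i ∨ t = j then 0 else (Fintype.card K : ℤ) - 1 := by
    intro t ht
    split_ifs with h
    · rcases h with rfl | rfl <;> simp
    · push Not at h
      have hb : ∀ b ∈ Finset.univ \ ({0} : Finset K), quadraticChar K (-(β ^ t * b) + β ^ i * b) *
          quadraticChar K (-(β ^ t * b) + β ^ j * b) = 1 := by
        intro b hb
        have hb0 : b ≠ 0 := by simpa using hb
        rw [show -(β ^ t * b) + β ^ i * b = (β ^ i - β ^ t) * b by ring,
          show -(β ^ t * b) + β ^ j * b = (β ^ j - β ^ t) * b by ring, map_mul, map_mul,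
          hβ.quadraticChar_sub hi ht h.1.symm, hβ.quadraticChar_sub hj ht h.2.symm,
          one_mul, ← _root_.sq, quadraticChar_sq_one hb0]
      have h1 : 1 ≤ Fintype.card K := Fintype.card_pos
      rw [Finset.sum_congr rfl hb, Finset.sum_const]
      simp [Finset.card_sdiff_of_subset, h1]
  rw [Finset.sum_congr rfl h2] at h1
  have h3 : ∑ t ∈ Finset.Icc 1 4, (if t = i ∨ t = j then (0 : ℤ) else (Fintype.card K : ℤ) - 1) =
      2 * ((Fintype.card K : ℤ) - 1) := by
    rw [Finset.mem_Icc] at hi hj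
    obtain ⟨i1, i2⟩ := hi
    obtain ⟨j1, j2⟩ := hj
    rw [Finset.sum_Icc_succ_top (by norm_num),
      Finset.sum_Icc_succ_top (by norm_num), Finset.sum_Icc_succ_top (by norm_num),
      Finset.Icc_self, Finset.sum_singleton]
    interval_cases i <;> interval_cases j <;> first | exact absurd rfl hij | (norm_num; ring)
  rw [h3] at h1
  simp only [mul_zero, add_zero, quadraticChar_zero] at h1
  linear_combination -h1

end PairSums

/-! ### Distribution of the sign sum -/

section Signs

variable {K : Type*} [Field K] [Fintype K] [DecidableEq K]

/-- The quadratic character of `(a + β ^ t b) g ^ t`. -/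
def sign (g β : K) (t : ℕ) (ab : K × K) : ℤ :=
  quadraticChar K ((ab.1 + β ^ t * ab.2) * g ^ t)

/-- The sum of the four quadratic characters attached to a pair. -/
def signSum (g β : K) (ab : K × K) : ℤ := ∑ t ∈ Finset.Icc 1 4, sign g β t ab

theorem signSum_eq (g β : K) (ab : K × K) :
    signSum g β ab = sign g β 1 ab + sign g β 2 ab + sign g β 3 ab + sign g β 4 ab := by
  rw [signSum, Finset.sum_Icc_succ_top (by norm_num),
    Finset.sum_Icc_succ_top (by norm_num), Finset.sum_Icc_succ_top (by norm_num),
    Finset.Icc_self, Finset.sum_singleton]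

theorem sign_mul {g β : K} {t : ℕ} {c : K} (hc : quadraticChar K c = -1) (ab : K × K) :
    sign g β t (c * ab.1, c * ab.2) = -sign g β t ab := by
  rw [sign, sign, show (c * ab.1 + β ^ t * (c * ab.2)) * g ^ t =
    c * ((ab.1 + β ^ t * ab.2) * g ^ t) by ring, map_mul, hc, neg_one_mul]

variable {g β : K} (hg : g ≠ 0) (hβ : IsFourthRoot β)
include hg hβ

theorem IsFourthRoot.sign_dichotomy {ab : K × K} (hab : ab ∈ offLineFinset K) {t : ℕ}
    (ht : t ∈ Finset.Icc 1 4) : sign g β t ab = 1 ∨ sign g β t ab = -1 := by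
  apply quadraticChar_dichotomy
  refine mul_ne_zero ?_ (pow_ne_zero _ hg)
  simp only [offLineFinset, Finset.mem_filter, Finset.mem_univ, true_and] at hab
  rw [← hβ.prod_eq, Finset.prod_ne_zero_iff] at hab
  exact hab t ht

omit hg in
theorem IsFourthRoot.sum_offLine_eq_zero {f : K × K → ℤ}
    (hf : ∀ c ab, quadraticChar K c = -1 → f (c * ab.1, c * ab.2) = -f ab) :
    ∑ ab ∈ offLineFinset K, f ab = 0 := by
  obtain ⟨c, hc⟩ := quadraticChar_exists_neg_one hβ.char
  have hc0 : c ≠ 0 := by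
    rintro rfl
    simp at hc
  rw [offLineFinset, Finset.sum_filter]
  refine sum_eq_zero_of_scaling hc0 fun ab => ?_
  have h1 : (c * ab.1) ^ 4 - (c * ab.2) ^ 4 ≠ 0 ↔ ab.1 ^ 4 - ab.2 ^ 4 ≠ 0 := by
    rw [show (c * ab.1) ^ 4 - (c * ab.2) ^ 4 = c ^ 4 * (ab.1 ^ 4 - ab.2 ^ 4) by ring]
    simp [hc0]
  simp only [h1, hf c ab hc]
  split_ifs <;> simp

omit hg in
theorem IsFourthRoot.sum_line_eq_zero {f : K × K → ℤ}
    (hf : ∀ c ab, quadraticChar K c = -1 → f (c * ab.1, c * ab.2) = -f ab) :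
    ∑ ab ∈ lineFinset K, f ab = 0 := by
  obtain ⟨c, hc⟩ := quadraticChar_exists_neg_one hβ.char
  have hc0 : c ≠ 0 := by
    rintro rfl
    simp at hc
  rw [lineFinset, Finset.sum_filter]
  refine sum_eq_zero_of_scaling hc0 fun ab => ?_
  have h1 : ((c * ab.1, c * ab.2) ≠ (0, 0) ∧ (c * ab.1) ^ 4 - (c * ab.2) ^ 4 = 0) ↔
      (ab ≠ (0, 0) ∧ ab.1 ^ 4 - ab.2 ^ 4 = 0) := by
    rw [show (c * ab.1) ^ 4 - (c * ab.2) ^ 4 = c ^ 4 * (ab.1 ^ 4 - ab.2 ^ 4) by ring]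
    simp [hc0, Prod.ext_iff]
  simp only [h1, hf c ab hc]
  split_ifs <;> simp

omit hg in
theorem IsFourthRoot.sum_offLine_sign_mul {i j : ℕ} (hi : i ∈ Finset.Icc 1 4)
    (hj : j ∈ Finset.Icc 1 4) (hij : i ≠ j) :
    ∑ ab ∈ offLineFinset K, sign g β i ab * sign g β j ab =
      -2 * ((Fintype.card K : ℤ) - 1) * quadraticChar K g ^ (i + j) := by
  rw [← hβ.sum_offLine_mul hi hj hij, Finset.sum_mul]
  refine Finset.sum_congr rfl fun ab _ => ?_
  rw [sign, sign, map_mul, map_mul, map_pow, map_pow]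
  ring

/-- The powers of `g` multiply to the square `g^10` and the forms to `a^4 - b^4`, whose character
vanishes on the lines, so the sum extends to the whole plane. -/
theorem IsFourthRoot.sum_offLine_sign_prod :
    ∑ ab ∈ offLineFinset K, sign g β 1 ab * sign g β 2 ab * sign g β 3 ab * sign g β 4 ab =
      ((Fintype.card K : ℤ) - 1) * (∑ a : K, quadraticChar K (a ^ 4 - 1) + 1) := by
  rw [← sum_quadraticChar_pow_four_sub_pow_four, offLineFinset, Finset.sum_filter]
  refine Finset.sum_congr rfl fun ab _ => ?_
  have h : sign g β 1 ab * sign g β 2 ab * sign g β 3 ab * sign g β 4 ab =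
      quadraticChar K (ab.1 ^ 4 - ab.2 ^ 4) := by
    have hp := hβ.prod_eq ab.1 ab.2
    rw [Finset.prod_Icc_succ_top (by norm_num), Finset.prod_Icc_succ_top (by norm_num),
      Finset.prod_Icc_succ_top (by norm_num), Finset.Icc_self, Finset.prod_singleton] at hp
    rw [← hp, sign, sign, sign, sign, ← map_mul, ← map_mul, ← map_mul]
    have : (ab.1 + β ^ 1 * ab.2) * g ^ 1 * ((ab.1 + β ^ 2 * ab.2) * g ^ 2) *
        ((ab.1 + β ^ 3 * ab.2) * g ^ 3) * ((ab.1 + β ^ 4 * ab.2) * g ^ 4) =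
        (g ^ 5) ^ 2 * ((ab.1 + β ^ 1 * ab.2) * (ab.1 + β ^ (1 + 1) * ab.2) *
          (ab.1 + β ^ (2 + 1) * ab.2) * (ab.1 + β ^ (3 + 1) * ab.2)) := by ring
    rw [this, map_mul, quadraticChar_sq_one' (pow_ne_zero _ hg), one_mul]
  rw [h]
  split_ifs with h0
  · rfl
  · push Not at h0
    rw [h0, quadraticChar_zero]

/-- Fourier expansion on `{±1}^4`, a group of order 16: `hv` writes the indicator of `v` in
elementary symmetric polynomials of the signs. Those of odd degree sum to zero; degree 2 gives `-4(r
- 1)(1 + 2χ(g))`, as `i + j` is even for two of the six index pairs. -/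
theorem IsFourthRoot.card_offLine_signSum (v c₀ c₁ c₂ c₃ c₄ : ℤ)
    (hv : ∀ s₁ s₂ s₃ s₄ : ℤ, s₁ = 1 ∨ s₁ = -1 → s₂ = 1 ∨ s₂ = -1 → s₃ = 1 ∨ s₃ = -1 →
      s₄ = 1 ∨ s₄ = -1 → (if s₁ + s₂ + s₃ + s₄ = v then 16 else 0) =
        c₀ + c₁ * (s₁ + s₂ + s₃ + s₄) +
        c₂ * (s₁ * s₂ + s₁ * s₃ + s₁ * s₄ + s₂ * s₃ + s₂ * s₄ + s₃ * s₄) +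
        c₃ * (s₁ * s₂ * s₃ + s₁ * s₂ * s₄ + s₁ * s₃ * s₄ + s₂ * s₃ * s₄) +
        c₄ * (s₁ * s₂ * s₃ * s₄)) :
    16 * (((offLineFinset K).filter fun ab => signSum g β ab = v).card : ℤ) =
      ((Fintype.card K : ℤ) - 1) * (c₀ * (Fintype.card K - 3) -
        4 * c₂ * (1 + 2 * quadraticChar K g) +
        c₄ * (∑ a : K, quadraticChar K (a ^ 4 - 1) + 1)) := by
  have h1 : 16 * (((offLineFinset K).filter fun ab => signSum g β ab = v).card : ℤ) =
      ∑ ab ∈ offLineFinset K, if signSum g β ab = v then 16 else 0 := by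
    rw [Finset.card_filter, Nat.cast_sum, Finset.mul_sum]
    refine Finset.sum_congr rfl fun ab _ => ?_
    split_ifs <;> simp
  have m1 : 1 ∈ Finset.Icc 1 4 := by decide
  have m2 : 2 ∈ Finset.Icc 1 4 := by decide
  have m3 : 3 ∈ Finset.Icc 1 4 := by decide
  have m4 : 4 ∈ Finset.Icc 1 4 := by decide
  rw [h1]
  simp only [signSum_eq]
  rw [Finset.sum_congr rfl fun ab hab => hv _ _ _ _ (hβ.sign_dichotomy hg hab m1)
    (hβ.sign_dichotomy hg hab m2) (hβ.sign_dichotomy hg hab m3) (hβ.sign_dichotomy hg hab m4)]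
  have hodd : ∑ ab ∈ offLineFinset K, (sign g β 1 ab + sign g β 2 ab + sign g β 3 ab +
      sign g β 4 ab) = 0 :=
    hβ.sum_offLine_eq_zero fun c ab hc => by
      simp only [sign_mul hc]
      ring
  have hodd3 : ∑ ab ∈ offLineFinset K, (sign g β 1 ab * sign g β 2 ab * sign g β 3 ab +
      sign g β 1 ab * sign g β 2 ab * sign g β 4 ab +
      sign g β 1 ab * sign g β 3 ab * sign g β 4 ab +
      sign g β 2 ab * sign g β 3 ab * sign g β 4 ab) = 0 :=
    hβ.sum_offLine_eq_zero fun c ab hc => by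
      simp only [sign_mul hc]
      ring
  have hsq : quadraticChar K g ^ 2 = 1 := quadraticChar_sq_one hg
  have heven : ∑ ab ∈ offLineFinset K, (sign g β 1 ab * sign g β 2 ab +
      sign g β 1 ab * sign g β 3 ab + sign g β 1 ab * sign g β 4 ab +
      sign g β 2 ab * sign g β 3 ab + sign g β 2 ab * sign g β 4 ab +
      sign g β 3 ab * sign g β 4 ab) =
      -4 * ((Fintype.card K : ℤ) - 1) * (1 + 2 * quadraticChar K g) := by
    simp only [Finset.sum_add_distrib]
    rw [hβ.sum_offLine_sign_mul m1 m2 (by decide), hβ.sum_offLine_sign_mul m1 m3 (by decide),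
      hβ.sum_offLine_sign_mul m1 m4 (by decide), hβ.sum_offLine_sign_mul m2 m3 (by decide),
      hβ.sum_offLine_sign_mul m2 m4 (by decide), hβ.sum_offLine_sign_mul m3 m4 (by decide)]
    rcases quadraticChar_dichotomy hg with he | he <;> rw [he] <;> norm_num <;> ring
  rw [Finset.sum_add_distrib, Finset.sum_add_distrib, Finset.sum_add_distrib,
    Finset.sum_add_distrib, ← Finset.mul_sum, ← Finset.mul_sum, ← Finset.mul_sum, ← Finset.mul_sum,
    hodd, hodd3, heven, hβ.sum_offLine_sign_prod hg, Finset.sum_const, nsmul_eq_mul,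
    hβ.card_offLine]
  ring

theorem IsFourthRoot.signSum_offLine {ab : K × K} (hab : ab ∈ offLineFinset K) :
    signSum g β ab = 4 ∨ signSum g β ab = -4 ∨ signSum g β ab = 2 ∨ signSum g β ab = -2 ∨
      signSum g β ab = 0 := by
  rw [signSum_eq]
  rcases hβ.sign_dichotomy hg hab (t := 1) (by decide) with h1 | h1 <;>
  rcases hβ.sign_dichotomy hg hab (t := 2) (by decide) with h2 | h2 <;>
  rcases hβ.sign_dichotomy hg hab (t := 3) (by decide) with h3 | h3 <;>
  rcases hβ.sign_dichotomy hg hab (t := 4) (by decide) with h4 | h4 <;>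
  rw [h1, h2, h3, h4] <;> norm_num

omit hg in
theorem IsFourthRoot.sign_line {t : ℕ} (ht : t ∈ Finset.Icc 1 4) (b : K) {j : ℕ}
    (hj : j ∈ Finset.Icc 1 4) :
    sign g β j (-(β ^ t * b), b) =
      if j = t then 0 else quadraticChar K b * quadraticChar K g ^ j := by
  rw [sign, show (-(β ^ t * b) + β ^ j * b) * g ^ j = (β ^ j - β ^ t) * (b * g ^ j) by ring]
  split_ifs with h
  · rw [h, sub_self, zero_mul, quadraticChar_zero]
  · rw [map_mul, hβ.quadraticChar_sub hj ht h, one_mul, map_mul, map_pow]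

omit hg [Fintype K] [DecidableEq K] in
theorem IsFourthRoot.exists_of_pow_four_sub_eq_zero {ab : K × K}
    (hab : ab.1 ^ 4 - ab.2 ^ 4 = 0) :
    ∃ t ∈ Finset.Icc 1 4, ab = (-(β ^ t * ab.2), ab.2) := by
  rw [← hβ.prod_eq, Finset.prod_eq_zero_iff] at hab
  obtain ⟨t, ht, h1⟩ := hab
  exact ⟨t, ht, Prod.ext (eq_neg_of_add_eq_zero_left h1) rfl⟩

/-- The three surviving signs are `χ(b) χ(g)^j`, `j ≠ t`. They all agree if `χ(g) = 1` and alternate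
with `j` otherwise, so the sum is `±3` or `±1`. -/
theorem IsFourthRoot.signSum_line {ab : K × K} (hab : ab ∈ lineFinset K) :
    signSum g β ab = 2 + quadraticChar K g ∨ signSum g β ab = -(2 + quadraticChar K g) := by
  simp only [lineFinset, Finset.mem_filter, Finset.mem_univ, true_and] at hab
  obtain ⟨t, ht, h⟩ := hβ.exists_of_pow_four_sub_eq_zero hab.2
  have hb0 : ab.2 ≠ 0 := by
    intro h0
    apply hab.1
    rw [h, h0, mul_zero, neg_zero]
  rw [h, signSum_eq, hβ.sign_line ht _ (by decide), hβ.sign_line ht _ (by decide),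
    hβ.sign_line ht _ (by decide), hβ.sign_line ht _ (by decide)]
  rw [Finset.mem_Icc] at ht
  obtain ⟨t1, t2⟩ := ht
  rcases quadraticChar_dichotomy hg with he | he <;>
  rcases quadraticChar_dichotomy hb0 with hb | hb <;>
  rw [he, hb] <;> interval_cases t <;> norm_num

theorem IsFourthRoot.card_line_signSum {v : ℤ}
    (hv : v = 2 + quadraticChar K g ∨ v = -(2 + quadraticChar K g)) :
    (((lineFinset K).filter fun ab => signSum g β ab = v).card : ℤ) =
      2 * ((Fintype.card K : ℤ) - 1) := by
  have hw : (2 : ℤ) + quadraticChar K g ≠ 0 := by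
    rcases quadraticChar_dichotomy hg with he | he <;> rw [he] <;> norm_num
  have hv0 : v ≠ 0 := by 
    rcases hv with rfl | rfl
    · exact hw
    · exact neg_ne_zero.2 hw
  -- The sign sum is `v` or `-v`, so `v + signSum` is `2v` or 0. As the sign sums add up to zero,
  -- both values are equally frequent.
  have h1 : 2 * v * (((lineFinset K).filter fun ab => signSum g β ab = v).card : ℤ) =
      ∑ ab ∈ lineFinset K, (v + signSum g β ab) := by
    rw [Finset.card_filter, Nat.cast_sum, Finset.mul_sum]
    refine Finset.sum_congr rfl fun ab hab => ?_
    have hs := hβ.signSum_line hg hab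
    split_ifs with h
    · rw [h]; push_cast; ring
    · have : signSum g β ab = -v := by
        rcases hv with rfl | rfl <;> rcases hs with hs | hs <;> first | exact absurd hs h | simp [hs]
      rw [this]
      simp
  have hz : ∑ ab ∈ lineFinset K, signSum g β ab = 0 :=
    hβ.sum_line_eq_zero fun c ab hc => by
      simp only [signSum_eq, sign_mul hc]
      ring
  rw [Finset.sum_add_distrib, hz, Finset.sum_const, nsmul_eq_mul, hβ.card_line] at h1
  apply mul_left_cancel₀ (mul_ne_zero two_ne_zero hv0)
  rw [h1]
  ring

end Signs

/-! ### From sign counts to value tables -/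

section Distribution

theorem isDistribution_of_factor {K ι : Type*} {D : Finset (K × K)} {lam : K → K → ℂ}
    {φ : ℤ → ℂ} (hφ : Function.Injective φ) {σ : K × K → ℤ}
    (hlam : ∀ ab ∈ D, lam ab.1 ab.2 = φ (σ ab)) {table : ι → ℂ × ℂ} {vals : ι → ℤ}
    (htab : ∀ j, (table j).1 = φ (vals j)) (hcov : ∀ ab ∈ D, ∃ j, σ ab = vals j)
    (hcard : ∀ j, ((D.filter fun ab => σ ab = vals j).card : ℂ) = (table j).2) :
    IsDistribution (D : Set (K × K)) lam table := by
  refine ⟨fun ab hab => ?_, fun j => ?_⟩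
  · obtain ⟨j, hj⟩ := hcov ab hab
    exact ⟨j, by rw [hlam ab hab, hj, htab]⟩
  · rw [← hcard j, ← Set.ncard_coe_finset]
    congr 2
    ext ab
    simp only [Finset.coe_filter, Set.mem_ofPred_eq, Finset.mem_coe]
    constructor
    · rintro ⟨h1, h2⟩
      rw [hlam ab h1, htab] at h2
      exact ⟨h1, hφ h2⟩
    · rintro ⟨h1, h2⟩
      exact ⟨h1, by rw [hlam ab h1, htab, h2]⟩

/-- `hinj` makes the level sets of different rows disjoint, so no pair is counted twice. -/
theorem IsDistribution.card_filter_eq_tableCount {K ι : Type*} [Fintype ι] {D : Finset (K × K)}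
    {lam : K → K → ℂ} {table : ι → ℂ × ℂ} (hD : IsDistribution (D : Set (K × K)) lam table)
    (hinj : Function.Injective fun j => (table j).1) (n q r h w : ℕ)
    [DecidablePred fun ab : K × K =>
      (w : ℂ) = n - h * ((r : ℂ) - 1) / (q * ((q : ℂ) - 1)) - lam ab.1 ab.2] :
    ((D.filter fun ab =>
      (w : ℂ) = n - h * ((r : ℂ) - 1) / (q * ((q : ℂ) - 1)) - lam ab.1 ab.2).card : ℂ) =
      tableCount n q r h table w := by
  classical
  rw [tableCount, Finset.sum_congr rfl fun j _ => (hD.2 j).symm, ← Nat.cast_sum]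
  congr 1
  have hset : ∀ j, {ab ∈ (D : Set (K × K)) | lam ab.1 ab.2 = (table j).1}.ncard =
      (D.filter fun ab => lam ab.1 ab.2 = (table j).1).card := by
    intro j
    rw [← Set.ncard_coe_finset]
    congr 1
    ext ab
    simp
  simp only [hset]
  rw [← Finset.card_biUnion]
  · congr 1
    ext ab
    simp only [Finset.mem_filter, Finset.mem_biUnion, Finset.mem_univ, true_and]
    constructor
    · rintro ⟨h1, h2⟩
      obtain ⟨j, hj⟩ := hD.1 ab h1
      exact ⟨j, by rw [← hj, h2], h1, hj⟩
    · rintro ⟨j, h1, h2, h3⟩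
      exact ⟨h2, by rw [h1, h3]⟩
  · intro i _ j _ hij
    rw [Function.onFun, Finset.disjoint_left]
    intro ab h1 h2
    rw [Finset.mem_filter] at h1 h2
    exact hij (hinj (h1.2.symm.trans h2.2))

end Distribution

/-! ### The modified weight as a function of the sign sum -/

section Generator

variable {F K : Type*} [Field F] [Fintype F] [DecidableEq F] [Field K] [Fintype K]
  [DecidableEq K] [Algebra F K] {h : ℕ} (H : Admissible F K h) {α : Kˣ}
  (hα : ∀ x : Kˣ, x ∈ Subgroup.zpowers α)
include H hα

omit [DecidableEq F] [DecidableEq K] in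
theorem Admissible.betaElt_sq : betaElt α 4 ^ 2 = -1 := by
  have hK4 := H.card_mod_four
  have h4 := betaElt_pow_four hα hK4
  have hf : (betaElt α 4 ^ 2 - 1) * (betaElt α 4 ^ 2 + 1) = 0 := by linear_combination h4
  rcases mul_eq_zero.1 hf with h1 | h1
  · exfalso
    rw [sub_eq_zero, betaElt, ← pow_mul, ← Units.val_pow_eq_pow_val, Units.val_eq_one] at h1
    have h2 := Nat.le_of_dvd ?_ (orderOf_dvd_of_pow_eq_one h1)
    · rw [orderOf_generator hα] at h2
      have : 1 < Fintype.card K := Fintype.one_lt_card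
      omega
    · have : 1 < Fintype.card K := Fintype.one_lt_card
      omega
  · exact eq_neg_of_add_eq_zero_left h1

omit [DecidableEq F] [DecidableEq K] in
theorem Admissible.exists_algebraMap_eq_betaElt : ∃ y : F, algebraMap F K y = betaElt α 4 := by
  obtain ⟨y, hy⟩ : IsSquare (-1 : F) := by
    rw [FiniteField.isSquare_neg_one_iff]
    have := H.four_dvd_card_sub_one
    omega
  have h1 : algebraMap F K y ^ 2 = -1 := by
    rw [← map_pow, sq, ← hy, map_neg, map_one]
  rcases sq_eq_sq_iff_eq_or_eq_neg.1 (h1.trans (H.betaElt_sq hα).symm) with h2 | h2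
  · exact ⟨y, h2⟩
  · exact ⟨-y, by rw [map_neg, h2, neg_neg]⟩

omit [DecidableEq F] [DecidableEq K] in
theorem Admissible.isFourthRoot : IsFourthRoot (betaElt α 4) where
  sq := H.betaElt_sq hα
  isSquare_sub i j := by
    obtain ⟨y, hy⟩ := H.exists_algebraMap_eq_betaElt hα
    rw [← hy, ← map_pow, ← map_pow, ← map_sub]
    exact H.isSquare_algebraMap _
  char := ringChar_ne_two_of_card_mod_four H.card_mod_four

omit [DecidableEq F] in
-- `β + 1` is a nonzero element of `F`, hence a square in `K`.
theorem Admissible.quadraticChar_gElt_mul :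
    quadraticChar K (gElt F α h * (betaElt α 4 + 1)) = quadraticChar K (gElt F α h) := by
  obtain ⟨y, hy⟩ := H.exists_algebraMap_eq_betaElt hα
  have h0 : betaElt α 4 + 1 ≠ 0 := by
    intro h0
    have h1 := H.betaElt_sq hα
    rw [eq_neg_of_add_eq_zero_left h0, neg_one_sq] at h1
    exact Ring.neg_one_ne_one_of_char_ne_two
      (ringChar_ne_two_of_card_mod_four H.card_mod_four) h1.symm
  have h1 : quadraticChar K (betaElt α 4 + 1) = 1 := by
    rw [quadraticChar_one_iff_isSquare h0, ← hy, ← map_one (algebraMap F K), ← map_add]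
    exact H.isSquare_algebraMap _
  rw [map_mul, h1, mul_one]

omit H hα [DecidableEq F] [Field F] [Fintype K] [DecidableEq K] [Algebra F K] in
theorem gElt_ne_zero : gElt F α h ≠ 0 := pow_ne_zero _ α.ne_zero

omit [DecidableEq F] in
theorem Admissible.genericPairs_eq : genericPairs α 4 = (offLineFinset K : Set (K × K)) := by
  ext ab
  simp only [genericPairs, offLineFinset, (H.isFourthRoot hα).prod_eq, Set.mem_ofPred_eq,
    Finset.coe_filter, Finset.mem_univ, true_and]

omit [DecidableEq F] in
theorem Admissible.degeneratePairs_eq : degeneratePairs α 4 = (lineFinset K : Set (K × K)) := by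
  ext ab
  simp only [degeneratePairs, lineFinset, ← (H.isFourthRoot hα).prod_eq, Set.mem_ofPred_eq,
    Finset.coe_filter, Finset.mem_univ, true_and, Finset.prod_eq_zero_iff]

variable (p : ℕ) [Fact p.Prime] [Algebra (ZMod p) K]

omit [DecidableEq F] in
theorem Admissible.modifiedWeight_eq (a b : K) :
    modifiedWeight p F α h 4 2 a b = h / (4 * Fintype.card F) *
      (∑ t ∈ Finset.Icc 1 4,
        (if a + betaElt α 4 ^ t * b = 0 then (Fintype.card K : ℂ) - 1 else -1) +
      signSum (gElt F α h) (betaElt α 4) (a, b) * quadraticGaussSum p K) := by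
  have hK4 := H.card_mod_four
  have h1 : 2 * ∑ i ∈ Finset.Icc 1 4,
      gaussPeriod p α 2 ((a + betaElt α 4 ^ i * b) * gElt F α h ^ i) =
      ∑ t ∈ Finset.Icc 1 4,
        (if a + betaElt α 4 ^ t * b = 0 then (Fintype.card K : ℂ) - 1 else -1) +
      signSum (gElt F α h) (betaElt α 4) (a, b) * quadraticGaussSum p K := by
    rw [Finset.mul_sum, Finset.sum_congr rfl fun i _ => two_mul_gaussPeriod p hα hK4 _,
      Finset.sum_add_distrib, signSum, Int.cast_sum, Finset.sum_mul]
    congr 1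
    refine Finset.sum_congr rfl fun t _ => ?_
    have hg := pow_ne_zero t (gElt_ne_zero (F := F) (α := α) (h := h))
    simp only [mul_eq_zero, hg, or_false]
  rw [modifiedWeight, ← h1]
  push_cast
  ring

/-- The possible values `h (c + v G) / (4 q)` of the modified weight. -/
noncomputable def weightValue (F K : Type*) [Fintype F] [Field K] [Fintype K] [DecidableEq K]
    [Algebra (ZMod p) K] (h : ℕ) (c : ℂ) (v : ℤ) : ℂ :=
  h / (4 * Fintype.card F) * (c + v * quadraticGaussSum p K)

omit [DecidableEq F] in
theorem Admissible.modifiedWeight_offLine {ab : K × K} (hab : ab ∈ offLineFinset K) :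
    modifiedWeight p F α h 4 2 ab.1 ab.2 =
      weightValue p F K h (-4) (signSum (gElt F α h) (betaElt α 4) ab) := by
  rw [H.modifiedWeight_eq hα, weightValue]
  simp only [offLineFinset, Finset.mem_filter, Finset.mem_univ, true_and] at hab
  rw [← (H.isFourthRoot hα).prod_eq, Finset.prod_ne_zero_iff] at hab
  rw [Finset.sum_congr rfl fun t ht => if_neg (hab t ht)]
  norm_num

omit [DecidableEq F] in
-- Exactly one of the four forms vanishes, so the constant is `(r - 1) - 3`.
theorem Admissible.modifiedWeight_line {ab : K × K} (hab : ab ∈ lineFinset K) :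
    modifiedWeight p F α h 4 2 ab.1 ab.2 =
      weightValue p F K h ((Fintype.card K : ℂ) - 4) (signSum (gElt F α h) (betaElt α 4) ab) := by
  have hβ := H.isFourthRoot hα
  rw [H.modifiedWeight_eq hα, weightValue]
  simp only [lineFinset, Finset.mem_filter, Finset.mem_univ, true_and] at hab
  obtain ⟨t, ht, h⟩ := hβ.exists_of_pow_four_sub_eq_zero hab.2
  have hb0 : ab.2 ≠ 0 := by
    intro h0
    apply hab.1
    rw [h, h0, mul_zero, neg_zero]
  have ha : ab.1 = -(betaElt α 4 ^ t * ab.2) := congrArg Prod.fst h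
  have hiff : ∀ i ∈ Finset.Icc 1 4, (if ab.1 + betaElt α 4 ^ i * ab.2 = 0 then
      (Fintype.card K : ℂ) - 1 else -1) = -1 + if i = t then (Fintype.card K : ℂ) else 0 := by
    intro i hi
    by_cases hit : i = t
    · rw [if_pos hit, if_pos (by rw [hit, ha]; ring)]
      ring
    · rw [if_neg hit, if_neg, add_zero]
      rw [ha, neg_add_eq_sub, ← sub_mul, mul_eq_zero, not_or, sub_eq_zero]
      exact ⟨fun h => hit (hβ.pow_injOn hi ht h), hb0⟩
  rw [Finset.sum_congr rfl hiff, Finset.sum_add_distrib, Finset.sum_ite_eq', if_pos ht]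
  congr 2
  norm_num
  ring

omit [DecidableEq F] in
theorem Admissible.modifiedWeight_zero :
    modifiedWeight p F α h 4 2 (0 : K) 0 =
      weightValue p F K h (4 * ((Fintype.card K : ℂ) - 1)) 0 := by
  rw [H.modifiedWeight_eq hα, weightValue, signSum_eq]
  simp only [sign, mul_zero, add_zero, zero_mul, quadraticChar_zero, if_true]
  norm_num
  exact Or.inl (by ring)

omit hα [DecidableEq F] in
theorem Admissible.quadraticGaussSum_sq : quadraticGaussSum p K ^ 2 = Fintype.card K :=
  TwoZeroCode.quadraticGaussSum_sq p H.card_mod_four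

omit hα [DecidableEq F] in
theorem Admissible.quadraticGaussSum_ne_zero : quadraticGaussSum p K ≠ 0 := by
  intro h0
  have h1 := H.quadraticGaussSum_sq p
  rw [h0, zero_pow two_ne_zero] at h1
  exact Fintype.card_ne_zero (α := K) (by exact_mod_cast h1.symm)

omit hα [DecidableEq F] [Fintype K] [DecidableEq K] [Fact p.Prime] [Algebra (ZMod p) K] in
theorem Admissible.div_ne_zero : (h : ℂ) / (4 * Fintype.card F) ≠ 0 := by
  have h1 : (h : ℂ) ≠ 0 := Nat.cast_ne_zero.2 H.pos.ne'
  have h2 : (Fintype.card F : ℂ) ≠ 0 := Nat.cast_ne_zero.2 Fintype.card_ne_zero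
  exact _root_.div_ne_zero h1 (mul_ne_zero (by norm_num) h2)

omit hα [DecidableEq F] in
theorem Admissible.weightValue_injective (c : ℂ) :
    Function.Injective (weightValue p F K h c) := by
  intro v w hvw
  have h1 := mul_left_cancel₀ H.div_ne_zero hvw
  have h2 := mul_right_cancel₀ (H.quadraticGaussSum_ne_zero p) (add_left_cancel h1)
  exact_mod_cast h2

omit hα [DecidableEq F] in
/-- Two equal values of the modified weight with different constant terms. -/
theorem Admissible.sq_eq_of_weightValue_eq {c d : ℂ} {v w : ℤ}
    (hvw : weightValue p F K h c v = weightValue p F K h d w) :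
    ((v : ℂ) - w) ^ 2 * Fintype.card K = (d - c) ^ 2 := by
  have h1 := mul_left_cancel₀ H.div_ne_zero hvw
  rw [← H.quadraticGaussSum_sq p]
  have h2 : ((v : ℂ) - w) * quadraticGaussSum p K = d - c := by linear_combination h1
  rw [← h2]
  ring

omit H [DecidableEq F] [Field F] [Fintype F] [Algebra F K] in
theorem gaussPeriod_one : 2 * gaussPeriod p α 2 (1 : K) = -1 + quadraticGaussSum p K := by
  rw [two_mul_gaussPeriod_of_ne_zero p hα one_ne_zero, map_one]
  simp

omit [DecidableEq F] in
theorem Admissible.gaussPeriod_generator :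
    2 * gaussPeriod p α 2 (α : K) = -1 - quadraticGaussSum p K := by
  rw [two_mul_gaussPeriod_of_ne_zero p hα α.ne_zero, quadraticChar_generator hα H.card_mod_four]
  push_cast
  ring

end Generator

/-! ### Frequencies of the rows -/

section Tables

variable {F K : Type*} [Field F] [Fintype F] [DecidableEq F] [Field K] [Fintype K]
  [DecidableEq K] [Algebra F K] {h : ℕ} (H : Admissible F K h) {α : Kˣ}
  (hα : ∀ x : Kˣ, x ∈ Subgroup.zpowers α) (p : ℕ) [Fact p.Prime] [Algebra (ZMod p) K]
include H hα

/-- The sign sums of the rows of the tables for generic pairs. -/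
def genericSigns : Fin 5 → ℤ := ![4, -4, 2, -2, 0]

omit [DecidableEq F] hα H [Field F] [Fintype F] [Fintype K] [DecidableEq K] [Field K]
  [Algebra F K] [Fact p.Prime] [Algebra (ZMod p) K] in
theorem genericSigns_injective : Function.Injective genericSigns := by decide

/-- The sign sums of the rows of the tables for degenerate pairs. -/
def degenerateSigns (e : ℤ) : Fin 2 → ℤ := ![2 + e, -(2 + e)]

omit [DecidableEq F] in
-- One formula in `χ(g) = ±1` covers both tables. The coefficients given to `key` are the Krawtchouk
-- values `K_j(0), …, K_j(4)` for length 4, where `j` is the number of negative signs; for instance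
-- `K_1(k) = 4 - 2k`.
theorem Admissible.card_offLine_genericSigns (T : ℂ)
    (hT : ((∑ a : K, quadraticChar K (a ^ 4 - 1) : ℤ) : ℂ) = -1 - T) (j : Fin 5) :
    (((offLineFinset K).filter fun ab =>
      signSum (gElt F α h) (betaElt α 4) ab = genericSigns j).card : ℂ) =
      ![((Fintype.card K : ℂ) - 1) * (Fintype.card K - 7 - 8 * quadraticChar K (gElt F α h) - T) / 16,
        ((Fintype.card K : ℂ) - 1) * (Fintype.card K - 7 - 8 * quadraticChar K (gElt F α h) - T) / 16,
        ((Fintype.card K : ℂ) - 1) * (Fintype.card K - 3 + T) / 4,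
        ((Fintype.card K : ℂ) - 1) * (Fintype.card K - 3 + T) / 4,
        ((Fintype.card K : ℂ) - 1) *
          (3 * Fintype.card K - 5 + 8 * quadraticChar K (gElt F α h) - 3 * T) / 8] j := by
  have hg : gElt F α h ≠ 0 := gElt_ne_zero
  have key := fun v c₀ c₁ c₂ c₃ c₄ hv => congrArg (Int.cast : ℤ → ℂ)
    ((H.isFourthRoot hα).card_offLine_signSum hg v c₀ c₁ c₂ c₃ c₄ hv)
  simp only [Int.cast_mul, Int.cast_add, Int.cast_sub, hT, Int.cast_natCast, Int.cast_one,
    Int.cast_ofNat] at key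
  match j with
  | 0 =>
    have := key (genericSigns 0) 1 1 1 1 1 (by
      rw [show genericSigns 0 = 4 from rfl]
      rintro _ _ _ _ (rfl | rfl) (rfl | rfl) (rfl | rfl) (rfl | rfl) <;> norm_num)
    simp only [Matrix.cons_val]
    push_cast at this
    linear_combination this / 16
  | 1 =>
    have := key (genericSigns 1) 1 (-1) 1 (-1) 1 (by
      rw [show genericSigns 1 = -4 from rfl]
      rintro _ _ _ _ (rfl | rfl) (rfl | rfl) (rfl | rfl) (rfl | rfl) <;> norm_num)
    simp only [Matrix.cons_val]
    push_cast at this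
    linear_combination this / 16
  | 2 =>
    have := key (genericSigns 2) 4 2 0 (-2) (-4) (by
      rw [show genericSigns 2 = 2 from rfl]
      rintro _ _ _ _ (rfl | rfl) (rfl | rfl) (rfl | rfl) (rfl | rfl) <;> norm_num)
    simp only [Matrix.cons_val]
    push_cast at this
    linear_combination this / 16
  | 3 =>
    have := key (genericSigns 3) 4 (-2) 0 2 (-4) (by
      rw [show genericSigns 3 = -2 from rfl]
      rintro _ _ _ _ (rfl | rfl) (rfl | rfl) (rfl | rfl) (rfl | rfl) <;> norm_num)
    simp only [Matrix.cons_val]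
    push_cast at this
    linear_combination this / 16
  | 4 =>
    have := key (genericSigns 4) 6 0 (-2) 0 6 (by
      rw [show genericSigns 4 = 0 from rfl]
      rintro _ _ _ _ (rfl | rfl) (rfl | rfl) (rfl | rfl) (rfl | rfl) <;> norm_num)
    simp only [Matrix.cons_val]
    push_cast at this
    linear_combination this / 16

omit [DecidableEq F] in
theorem Admissible.card_line_degenerateSigns (j : Fin 2) :
    (((lineFinset K).filter fun ab => signSum (gElt F α h) (betaElt α 4) ab =
      degenerateSigns (quadraticChar K (gElt F α h)) j).card : ℂ) =
      2 * ((Fintype.card K : ℂ) - 1) := by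
  have h1 := (H.isFourthRoot hα).card_line_signSum (v := degenerateSigns
    (quadraticChar K (gElt F α h)) j) (gElt_ne_zero (F := F) (α := α) (h := h)) (by
      fin_cases j
      · exact Or.inl rfl
      · exact Or.inr rfl)
  have h2 := congrArg (Int.cast : ℤ → ℂ) h1
  push_cast at h2
  exact h2

omit [DecidableEq F] in
theorem Admissible.isDistribution_generic {table : Fin 5 → ℂ × ℂ} (T : ℂ)
    (hT : ((∑ a : K, quadraticChar K (a ^ 4 - 1) : ℤ) : ℂ) = -1 - T)
    (htab : ∀ j, (table j).1 = weightValue p F K h (-4) (genericSigns j))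
    (hfreq : ∀ j, (table j).2 =
      ![((Fintype.card K : ℂ) - 1) * (Fintype.card K - 7 - 8 * quadraticChar K (gElt F α h) - T) / 16,
        ((Fintype.card K : ℂ) - 1) * (Fintype.card K - 7 - 8 * quadraticChar K (gElt F α h) - T) / 16,
        ((Fintype.card K : ℂ) - 1) * (Fintype.card K - 3 + T) / 4,
        ((Fintype.card K : ℂ) - 1) * (Fintype.card K - 3 + T) / 4,
        ((Fintype.card K : ℂ) - 1) *
          (3 * Fintype.card K - 5 + 8 * quadraticChar K (gElt F α h) - 3 * T) / 8] j) :
    IsDistribution (offLineFinset K : Set (K × K)) (modifiedWeight p F α h 4 2) table := by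
  refine isDistribution_of_factor (H.weightValue_injective p (-4))
    (fun ab hab => H.modifiedWeight_offLine hα p hab) htab (fun ab hab => ?_) fun j => ?_
  · rcases (H.isFourthRoot hα).signSum_offLine (gElt_ne_zero (F := F) (α := α) (h := h)) hab with
      h | h | h | h | h
    · exact ⟨0, h⟩
    · exact ⟨1, h⟩
    · exact ⟨2, h⟩
    · exact ⟨3, h⟩
    · exact ⟨4, h⟩
  · rw [H.card_offLine_genericSigns hα T hT, hfreq]

omit [DecidableEq F] in
theorem Admissible.isDistribution_degenerate {table : Fin 2 → ℂ × ℂ}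
    (htab : ∀ j, (table j).1 = weightValue p F K h ((Fintype.card K : ℂ) - 4)
      (degenerateSigns (quadraticChar K (gElt F α h)) j))
    (hfreq : ∀ j, (table j).2 = 2 * ((Fintype.card K : ℂ) - 1)) :
    IsDistribution (lineFinset K : Set (K × K)) (modifiedWeight p F α h 4 2) table := by
  refine isDistribution_of_factor (H.weightValue_injective p ((Fintype.card K : ℂ) - 4))
    (fun ab hab => H.modifiedWeight_line hα p hab) htab (fun ab hab => ?_) fun j => ?_
  · rcases (H.isFourthRoot hα).signSum_line (gElt_ne_zero (F := F) (α := α) (h := h)) hab with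
      h | h
    · exact ⟨0, h⟩
    · exact ⟨1, h⟩
  · rw [H.card_line_degenerateSigns hα, hfreq]

end Tables

/-! ### Distinctness of values, injectivity of the encoding, eight weights -/

section Weights

variable {F K : Type*} [Field F] [Fintype F] [DecidableEq F] [Field K] [Fintype K]
  [DecidableEq K] [Algebra F K] {h : ℕ} (H : Admissible F K h) {α : Kˣ}
  (hα : ∀ x : Kˣ, x ∈ Subgroup.zpowers α) (p : ℕ) [Fact p.Prime] [Algebra (ZMod p) K]

omit [DecidableEq F] [DecidableEq K] in
theorem codeword_sub (e : ℕ) (a b a' b' : K) :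
    codeword F α h e (a - a') (b - b') = codeword F α h e a b - codeword F α h e a' b' := by
  funext i
  simp only [codeword, Pi.sub_apply, ← map_sub]
  congr 1
  ring

omit [DecidableEq F] [DecidableEq K] in
theorem codeword_zero (e : ℕ) : codeword F α h e (0 : K) 0 = 0 := by
  have := codeword_sub (F := F) (α := α) (h := h) e 0 0 0 0
  rwa [sub_self, sub_self] at this

omit [DecidableEq F] [DecidableEq K] in
theorem code_eq_range (e : ℕ) :
    code F α h e = Set.range fun ab : K × K => codeword F α h e ab.1 ab.2 := by
  ext c
  simp only [code, Set.mem_ofPred_eq, Set.mem_range, Prod.exists, eq_comm]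

theorem abs_genericSigns_le (j : Fin 5) : |genericSigns j| ≤ 4 := by
  revert j
  decide

theorem abs_degenerateSigns_le {e : ℤ} (he : e = 1 ∨ e = -1) (j : Fin 2) :
    |degenerateSigns e j| ≤ 3 := by
  rcases he with rfl | rfl <;> revert j <;> decide

theorem degenerateSigns_injective {e : ℤ} (he : e = 1 ∨ e = -1) :
    Function.Injective (degenerateSigns e) := by
  rcases he with rfl | rfl <;> decide

/-- The value of the modified weight in each class of pairs: the pair `(0,0)`, and the rows of the
tables for generic and for degenerate pairs. -/
noncomputable def rowValue (F K : Type*) [Fintype F] [Field K] [Fintype K] [DecidableEq K]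
    [Algebra (ZMod p) K] (h : ℕ) (e : ℤ) : Option (Fin 5 ⊕ Fin 2) → ℂ
  | none => weightValue p F K h (4 * ((Fintype.card K : ℂ) - 1)) 0
  | some (Sum.inl j) => weightValue p F K h (-4) (genericSigns j)
  | some (Sum.inr j) => weightValue p F K h ((Fintype.card K : ℂ) - 4) (degenerateSigns e j)

include H

omit [DecidableEq F] in
-- The constants `-4`, `r - 4`, `4r - 4` differ by multiples of `r`, and `G² = r`; squaring makes
-- the sign of `G` irrelevant.
theorem Admissible.sq_eq_mul_card {c d : ℂ} {v w : ℤ} {k : ℕ}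
    (hcd : d - c = k * Fintype.card K)
    (hvw : weightValue p F K h c v = weightValue p F K h d w) :
    (v - w) ^ 2 = (k : ℤ) ^ 2 * Fintype.card K := by
  have h1 := H.sq_eq_of_weightValue_eq p hvw
  have h2 : (Fintype.card K : ℂ) ≠ 0 := Nat.cast_ne_zero.2 Fintype.card_ne_zero
  rw [hcd] at h1
  have h3 : ((v : ℂ) - w) ^ 2 = (k : ℂ) ^ 2 * Fintype.card K :=
    mul_right_cancel₀ h2 (by rw [h1]; ring)
  exact_mod_cast h3

omit [DecidableEq F] in
theorem Admissible.rowValue_some_ne_none {e : ℤ} (he : e = 1 ∨ e = -1) (x : Fin 5 ⊕ Fin 2) :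
    rowValue p F K h e (some x) ≠ rowValue p F K h e none := by
  have hK : (1 : ℤ) < Fintype.card K := by exact_mod_cast Fintype.one_lt_card
  rcases x with j | j <;> intro heq <;> simp only [rowValue] at heq
  · have h1 := H.sq_eq_mul_card p (k := 4) (by push_cast; ring) heq
    have h2 := abs_le.1 (abs_genericSigns_le j)
    push_cast at h1
    nlinarith
  · have h1 := H.sq_eq_mul_card p (k := 3) (by push_cast; ring) heq
    have h2 := abs_le.1 (abs_degenerateSigns_le he j)
    push_cast at h1
    nlinarith

omit [DecidableEq F] in
-- Generic sign sums are at most 4 in absolute value and degenerate ones at most 3, so a coincidence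
-- would need `r ≤ (4 + 3)² = 49`.
theorem Admissible.rowValue_injective {e : ℤ} (he : e = 1 ∨ e = -1)
    (hK : 49 < Fintype.card K) : Function.Injective (rowValue p F K h e) := by
  have hK' : (49 : ℤ) < Fintype.card K := by exact_mod_cast hK
  have hne : ∀ i j, rowValue p F K h e (some (Sum.inl i)) ≠
      rowValue p F K h e (some (Sum.inr j)) := by
    intro i j heq
    have h1 := H.sq_eq_mul_card p (k := 1) (by push_cast; ring) heq
    have h2 := abs_le.1 (abs_genericSigns_le i)
    have h3 := abs_le.1 (abs_degenerateSigns_le he j)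
    push_cast at h1
    nlinarith
  rintro (_ | x) (_ | y) heq
  · rfl
  · exact absurd heq.symm (H.rowValue_some_ne_none p he y)
  · exact absurd heq (H.rowValue_some_ne_none p he x)
  · rcases x with i | i <;> rcases y with j | j
    · rw [genericSigns_injective (H.weightValue_injective p _ heq)]
    · exact absurd heq (hne i j)
    · exact absurd heq.symm (hne j i)
    · rw [degenerateSigns_injective he (H.weightValue_injective p _ heq)]

omit H [DecidableEq F] [Field F] [Algebra F K] in
theorem quadraticChar_gElt : quadraticChar K (gElt F α h) = 1 ∨
    quadraticChar K (gElt F α h) = -1 := quadraticChar_dichotomy gElt_ne_zero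

include hα

omit [DecidableEq F] in
theorem Admissible.exists_modifiedWeight_eq {ab : K × K} (hab : ab ≠ 0) :
    ∃ x, modifiedWeight p F α h 4 2 ab.1 ab.2 =
      rowValue p F K h (quadraticChar K (gElt F α h)) (some x) := by
  have hβ := H.isFourthRoot hα
  have hg : gElt F α h ≠ 0 := gElt_ne_zero
  by_cases h0 : ab.1 ^ 4 - ab.2 ^ 4 = 0
  · have hl : ab ∈ lineFinset K := by
      simp only [lineFinset, Finset.mem_filter, Finset.mem_univ, true_and]
      exact ⟨hab, h0⟩
    rw [H.modifiedWeight_line hα p hl]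
    rcases hβ.signSum_line hg hl with h1 | h1 <;> rw [h1]
    exacts [⟨Sum.inr 0, rfl⟩, ⟨Sum.inr 1, rfl⟩]
  · have hl : ab ∈ offLineFinset K := by
      simp only [offLineFinset, Finset.mem_filter, Finset.mem_univ, true_and]
      exact h0
    rw [H.modifiedWeight_offLine hα p hl]
    rcases hβ.signSum_offLine hg hl with h1 | h1 | h1 | h1 | h1 <;> rw [h1]
    exacts [⟨Sum.inl 0, rfl⟩, ⟨Sum.inl 1, rfl⟩, ⟨Sum.inl 2, rfl⟩, ⟨Sum.inl 3, rfl⟩,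
      ⟨Sum.inl 4, rfl⟩]

/-- The weight determines `λ`, and no nonzero pair has the value of `λ` found at `(0,0)`. -/
theorem Admissible.codeword_ne_zero {ab : K × K} (hab : ab ≠ 0) :
    codeword F α h 4 ab.1 ab.2 ≠ 0 := by
  intro h0
  obtain ⟨p, _⟩ := CharP.exists K
  have : Fact p.Prime := ⟨CharP.char_is_prime K p⟩
  let : Algebra (ZMod p) K := ZMod.algebra K p
  obtain ⟨x, hx⟩ := H.exists_modifiedWeight_eq hα p hab
  have h1 := H.hammingNorm_codeword (p := p) hα ab.1 ab.2
  have h2 := H.hammingNorm_codeword (p := p) hα 0 0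
  rw [h0] at h1
  rw [codeword_zero, h1, hx, H.modifiedWeight_zero hα p] at h2
  exact H.rowValue_some_ne_none p quadraticChar_gElt x (sub_right_injective h2)

theorem Admissible.codeword_injective :
    Function.Injective fun ab : K × K => codeword F α h 4 ab.1 ab.2 := by
  intro ab cd heq
  by_contra hne
  refine H.codeword_ne_zero hα (ab := ab - cd) (sub_ne_zero.2 hne) ?_
  rw [Prod.fst_sub, Prod.snd_sub, codeword_sub]
  exact sub_eq_zero.2 heq

theorem Admissible.weightCount_eq_card (w : ℕ) : weightCount F α h 4 w =
    (Finset.univ.filter fun ab : K × K => hammingNorm (codeword F α h 4 ab.1 ab.2) = w).card := by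
  rw [weightCount, ← Set.ncard_coe_finset,
    ← Set.ncard_image_of_injective _ (H.codeword_injective hα)]
  congr 1
  ext c
  simp only [code_eq_range, Set.mem_ofPred_eq, Set.mem_range, Set.mem_image, Finset.coe_filter,
    Finset.mem_univ, true_and]
  constructor
  · rintro ⟨⟨ab, rfl⟩, h⟩
    exact ⟨ab, h, rfl⟩
  · rintro ⟨ab, h, rfl⟩
    exact ⟨⟨ab, rfl⟩, h⟩

theorem Admissible.weightCount_eq {t : Fin 5 → ℂ × ℂ} {t' : Fin 2 → ℂ × ℂ}
    (ht : IsDistribution (offLineFinset K : Set (K × K)) (modifiedWeight p F α h 4 2) t)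
    (ht' : IsDistribution (lineFinset K : Set (K × K)) (modifiedWeight p F α h 4 2) t')
    (htab : ∀ j, (t j).1 = weightValue p F K h (-4) (genericSigns j))
    (htab' : ∀ j, (t' j).1 = weightValue p F K h ((Fintype.card K : ℂ) - 4)
      (degenerateSigns (quadraticChar K (gElt F α h)) j)) (w : ℕ) :
    (weightCount F α h 4 w : ℂ) = (if w = 0 then 1 else 0) +
      tableCount (codeLength F K h) (Fintype.card F) (Fintype.card K) h t w +
      tableCount (codeLength F K h) (Fintype.card F) (Fintype.card K) h t' w := by
  classical
  have hinj : Function.Injective fun j => (t j).1 := by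
    simp only [htab]
    exact (H.weightValue_injective p _).comp genericSigns_injective
  have hinj' : Function.Injective fun j => (t' j).1 := by
    simp only [htab']
    exact (H.weightValue_injective p _).comp (degenerateSigns_injective quadraticChar_gElt)
  rw [← ht.card_filter_eq_tableCount hinj, ← ht'.card_filter_eq_tableCount hinj',
    H.weightCount_eq_card hα]
  have hiff : ∀ ab : K × K, hammingNorm (codeword F α h 4 ab.1 ab.2) = w ↔
      (w : ℂ) = codeLength F K h - h * ((Fintype.card K : ℂ) - 1) /
        (Fintype.card F * ((Fintype.card F : ℂ) - 1)) -
        modifiedWeight p F α h 4 2 ab.1 ab.2 := by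
    intro ab
    rw [← H.hammingNorm_codeword hα, Nat.cast_inj, eq_comm]
  simp only [← hiff]
  have key := sum_univ_eq (K := K) fun ab =>
    if hammingNorm (codeword F α h 4 ab.1 ab.2) = w then 1 else 0
  simp only [Finset.sum_boole, codeword_zero, hammingNorm_zero] at key
  have key' := congrArg (Int.cast : ℤ → ℂ) key
  push_cast at key'
  rw [key']
  simp only [eq_comm (a := 0) (b := w)]
  ring

omit [DecidableEq F] in
-- Every row has positive frequency. Here `T` is half the trace, so `|T| ≤ R = √r`.
theorem Admissible.exists_eq_rowValue {R : ℕ} (hR : 9 ≤ R) (hK : Fintype.card K = R ^ 2) (T : ℤ)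
    (hT : ∑ a : K, quadraticChar K (a ^ 4 - 1) = -1 - 2 * T)
    (hTK : T ^ 2 ≤ Fintype.card K) (x : Option (Fin 5 ⊕ Fin 2)) :
    ∃ ab : K × K, modifiedWeight p F α h 4 2 ab.1 ab.2 =
      rowValue p F K h (quadraticChar K (gElt F α h)) x := by
  have hR' : (9 : ℤ) ≤ R := by exact_mod_cast hR
  have hK' : (Fintype.card K : ℤ) = (R : ℤ) ^ 2 := by exact_mod_cast hK
  rw [hK'] at hTK
  obtain ⟨hT1, hT2⟩ := abs_le.1 (abs_le_of_sq_le_sq hTK (by positivity))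
  rcases x with _ | j | j
  · exact ⟨(0, 0), H.modifiedWeight_zero hα p⟩
  · obtain ⟨ab, hab⟩ : ((offLineFinset K).filter fun ab =>
        signSum (gElt F α h) (betaElt α 4) ab = genericSigns j).Nonempty := by
      rw [← Finset.card_ne_zero, ← Nat.cast_ne_zero (R := ℂ),
        H.card_offLine_genericSigns hα ((2 * T : ℤ) : ℂ) (by rw [hT]; push_cast; ring)]
      have h0 : ((Fintype.card K : ℂ) - 1) ≠ 0 := sub_ne_zero.2
        (by exact_mod_cast (show Fintype.card K ≠ 1 by nlinarith))
      have hne : ∀ {x : ℂ} (y : ℤ), x = y → 0 < y → x ≠ 0 := by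
        rintro _ y rfl hy
        exact Int.cast_ne_zero.2 hy.ne'
      have h1 : ((Fintype.card K : ℂ) - 7 - 8 * quadraticChar K (gElt F α h) - (2 * T : ℤ)) ≠ 0 := by
        refine hne (Fintype.card K - 7 - 8 * quadraticChar K (gElt F α h) - 2 * T)
          (by push_cast; ring) ?_
        -- The worst case is `R² - 2R - 15 = (R - 5)(R + 3)`, which is 0 at `R = 5`.
        rcases quadraticChar_gElt (F := F) (α := α) (h := h) with h | h <;> rw [h, hK'] <;> nlinarith
      have h2 : ((Fintype.card K : ℂ) - 3 + (2 * T : ℤ)) ≠ 0 := by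
        refine hne (Fintype.card K - 3 + 2 * T) (by push_cast; ring) ?_
        rw [hK']
        nlinarith
      have h3 : (3 * (Fintype.card K : ℂ) - 5 + 8 * quadraticChar K (gElt F α h) -
          3 * (2 * T : ℤ)) ≠ 0 := by
        refine hne (3 * Fintype.card K - 5 + 8 * quadraticChar K (gElt F α h) - 3 * (2 * T))
          (by push_cast; ring) ?_
        rcases quadraticChar_gElt (F := F) (α := α) (h := h) with h | h <;> rw [h, hK'] <;> nlinarith
      match j with
      | 0 => exact _root_.div_ne_zero (mul_ne_zero h0 h1) (by norm_num)
      | 1 => exact _root_.div_ne_zero (mul_ne_zero h0 h1) (by norm_num)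
      | 2 => exact _root_.div_ne_zero (mul_ne_zero h0 h2) (by norm_num)
      | 3 => exact _root_.div_ne_zero (mul_ne_zero h0 h2) (by norm_num)
      | 4 => exact _root_.div_ne_zero (mul_ne_zero h0 h3) (by norm_num)
    rw [Finset.mem_filter] at hab
    exact ⟨ab, by rw [H.modifiedWeight_offLine hα p hab.1, hab.2]; rfl⟩
  · obtain ⟨ab, hab⟩ : ((lineFinset K).filter fun ab =>
        signSum (gElt F α h) (betaElt α 4) ab =
          degenerateSigns (quadraticChar K (gElt F α h)) j).Nonempty := by
      rw [← Finset.card_ne_zero, ← Nat.cast_ne_zero (R := ℂ), H.card_line_degenerateSigns hα]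
      refine mul_ne_zero two_ne_zero (sub_ne_zero.2 ?_)
      exact_mod_cast (show Fintype.card K ≠ 1 by nlinarith)
    rw [Finset.mem_filter] at hab
    exact ⟨ab, by rw [H.modifiedWeight_line hα p hab.1, hab.2]; rfl⟩

omit H [DecidableEq F] [DecidableEq K] hα in
theorem Admissible.exists_card_eq_sq (H : Admissible F K h)
    (hne : ¬ (Fintype.card F = 5 ∧ Module.finrank F K = 2)) :
    ∃ R : ℕ, 9 ≤ R ∧ Fintype.card K = R ^ 2 := by
  obtain ⟨k, hk⟩ := H.even_finrank
  have h4 := H.four_dvd_card_sub_one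
  have h1 : 1 < Fintype.card F := Fintype.one_lt_card
  have hmod : Fintype.card F ^ k ≡ 1 [MOD 4] := by
    have : Fintype.card F ≡ 1 [MOD 4] := ((Nat.modEq_iff_dvd' h1.le).2 h4).symm
    simpa using this.pow k
  have hk0 : k ≠ 0 := by
    have := H.finrank_pos
    omega
  have hle : Fintype.card F ≤ Fintype.card F ^ k := Nat.le_self_pow hk0 _
  -- `R = q^(m/2)` exceeds 1 and is 1 modulo 4, so `R = 5` is the only possibility below 9.
  refine ⟨Fintype.card F ^ k, ?_, by
    rw [Module.card_eq_pow_finrank (K := F) (V := K), hk, ← pow_mul, mul_comm]⟩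
  by_contra! hlt
  have h5 : Fintype.card F ^ k = 5 := by
    unfold Nat.ModEq at hmod
    omega
  have hF : Fintype.card F = 5 := by omega
  refine hne ⟨hF, ?_⟩
  rw [hF] at h5
  have : k = 1 := Nat.pow_right_injective (le_refl 2 |>.trans (by norm_num : 2 ≤ 5))
    (by simpa using h5)
  omega

theorem Admissible.ncard_weights
    (hne : ¬ (Fintype.card F = 5 ∧ Module.finrank F K = 2)) :
    (hammingNorm '' code F α h 4).ncard = 8 := by
  obtain ⟨p, _⟩ := CharP.exists K
  have : Fact p.Prime := ⟨CharP.char_is_prime K p⟩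
  let : Algebra (ZMod p) K := ZMod.algebra K p
  obtain ⟨R, hR, hK⟩ := H.exists_card_eq_sq hne
  obtain ⟨z, hz, -, hT, -⟩ := exists_gaussianInt_of_card H.card_mod_four
  have hTK : z.re ^ 2 ≤ Fintype.card K := by
    rw [← hz, Zsqrtd.norm_def]
    nlinarith [sq_nonneg z.im]
  set φ : ℂ → ℂ := fun x => codeLength F K h - h * ((Fintype.card K : ℂ) - 1) /
    (Fintype.card F * ((Fintype.card F : ℂ) - 1)) - x
  have hφ : Function.Injective φ := sub_right_injective
  -- The weights correspond injectively to `Option (Fin 5 ⊕ Fin 2)`, which has 1 + 5 + 2 elements.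
  have himage : (Nat.cast : ℕ → ℂ) '' (hammingNorm '' code F α h 4) =
      Set.range (φ ∘ rowValue p F K h (quadraticChar K (gElt F α h))) := by
    rw [code_eq_range, ← Set.range_comp, ← Set.range_comp]
    apply Set.Subset.antisymm
    · rintro _ ⟨ab, rfl⟩
      simp only [Function.comp, H.hammingNorm_codeword (p := p) hα]
      by_cases hab : ab = 0
      · exact ⟨none, by rw [hab]; exact congrArg φ (H.modifiedWeight_zero hα p).symm⟩
      · obtain ⟨x, hx⟩ := H.exists_modifiedWeight_eq hα p hab
        exact ⟨some x, congrArg φ hx.symm⟩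
    · rintro _ ⟨x, rfl⟩
      obtain ⟨ab, hab⟩ := H.exists_eq_rowValue hα p hR hK z.re hT hTK x
      refine ⟨ab, ?_⟩
      simp only [Function.comp, H.hammingNorm_codeword (p := p) hα, hab, φ]
  rw [← Set.ncard_image_of_injective _ (Nat.cast_injective (R := ℂ)), himage, ← Set.image_univ,
    Set.ncard_image_of_injective _
      (hφ.comp (H.rowValue_injective p quadraticChar_gElt (by nlinarith))), Set.ncard_univ,
    Nat.card_eq_fintype_card]
  rfl

omit H hα [DecidableEq K] in
theorem ncard_nonzero_weights {k : ℕ} (hk : (hammingNorm '' code F α h 4).ncard = k + 1) :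
    {w ∈ hammingNorm '' code F α h 4 | w ≠ 0}.ncard = k := by
  have h0 : 0 ∈ hammingNorm '' code F α h 4 :=
    ⟨0, ⟨0, 0, codeword_zero (F := F) (α := α) (h := h) 4 |>.symm⟩, hammingNorm_zero⟩
  have : {w ∈ hammingNorm '' code F α h 4 | w ≠ 0} = hammingNorm '' code F α h 4 \ {0} := rfl
  rw [this, Set.ncard_sdiff_singleton_of_mem h0, hk, Nat.add_sub_cancel]

end Weights

/-! ### Table entries rewritten with `G = 1 + 2A` and `B = -1 - A` -/

section TableValues

variable {F K : Type*} [Fintype F] [Field K] [Fintype K] [DecidableEq K]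
  (p : ℕ) [Fact p.Prime] [Algebra (ZMod p) K] {A B : ℂ}
  (hA : 2 * A = -1 + quadraticGaussSum p K) (hB : 2 * B = -1 - quadraticGaussSum p K) (h : ℕ)
include hA hB

theorem table1_fst (T : ℂ) (j : Fin 5) :
    (table1 (Fintype.card F) (Fintype.card K) h A B T j).1 =
      weightValue p F K h (-4) (genericSigns j) := by
  rw [weightValue, show quadraticGaussSum p K = 1 + 2 * A by linear_combination -hA]
  obtain rfl : B = -1 - A := by linear_combination (hA + hB) / 2
  match j with
  | 0 =>
    rw [show genericSigns 0 = 4 from rfl]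
    simp only [table1, Matrix.cons_val]
    push_cast
    field
  | 1 =>
    rw [show genericSigns 1 = -4 from rfl]
    simp only [table1, Matrix.cons_val]
    push_cast
    field
  | 2 =>
    rw [show genericSigns 2 = 2 from rfl]
    simp only [table1, Matrix.cons_val]
    push_cast
    field
  | 3 =>
    rw [show genericSigns 3 = -2 from rfl]
    simp only [table1, Matrix.cons_val]
    push_cast
    field
  | 4 =>
    rw [show genericSigns 4 = 0 from rfl]
    simp only [table1, Matrix.cons_val]
    push_cast
    field

theorem table2_fst (T : ℂ) (j : Fin 5) :
    (table2 (Fintype.card F) (Fintype.card K) h A B T j).1 =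
      weightValue p F K h (-4) (genericSigns j) := by
  rw [← table1_fst p hA hB h T]
  match j with
  | 0 => simp only [table1, table2, Matrix.cons_val]
  | 1 => simp only [table1, table2, Matrix.cons_val]
  | 2 => simp only [table1, table2, Matrix.cons_val]
  | 3 => simp only [table1, table2, Matrix.cons_val]
  | 4 => simp only [table1, table2, Matrix.cons_val]

theorem table3_fst (j : Fin 2) :
    (table3 (Fintype.card F) (Fintype.card K) h A B j).1 =
      weightValue p F K h ((Fintype.card K : ℂ) - 4) (degenerateSigns 1 j) := by
  rw [weightValue, show quadraticGaussSum p K = 1 + 2 * A by linear_combination -hA]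
  obtain rfl : B = -1 - A := by linear_combination (hA + hB) / 2
  match j with
  | 0 =>
    rw [show degenerateSigns 1 0 = 3 from rfl]
    simp only [table3, Matrix.cons_val]
    push_cast
    field
  | 1 =>
    rw [show degenerateSigns 1 1 = -3 from rfl]
    simp only [table3, Matrix.cons_val]
    push_cast
    field

theorem table4_fst (j : Fin 2) :
    (table4 (Fintype.card F) (Fintype.card K) h A B j).1 =
      weightValue p F K h ((Fintype.card K : ℂ) - 4) (degenerateSigns (-1) j) := by
  rw [weightValue, show quadraticGaussSum p K = 1 + 2 * A by linear_combination -hA]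
  obtain rfl : B = -1 - A := by linear_combination (hA + hB) / 2
  match j with
  | 0 =>
    rw [show degenerateSigns (-1) 0 = 1 from rfl]
    simp only [table4, Matrix.cons_val]
    push_cast
    field
  | 1 =>
    rw [show degenerateSigns (-1) 1 = -1 from rfl]
    simp only [table4, Matrix.cons_val]
    push_cast
    field

end TableValues

end TwoZeroCode

/-! ### Assembly of the main theorem -/

theorem mainTheorem1
    (p s m h q r : ℕ) [Fact p.Prime]
    (F K : Type*) [Field F] [Fintype F] [DecidableEq F] [Field K] [Fintype K]
    [Algebra F K] [Algebra (ZMod p) K]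
    (hq : q = p ^ s) (hF : Fintype.card F = q)
    (hm : Module.finrank F K = m) (hr : r = q ^ m)
    (α : Kˣ) (hα : ∀ x : Kˣ, x ∈ Subgroup.zpowers α)
    (h_four : 4 ∣ h) (h_dvd : h ∣ q - 1)
    (h_gcd : Nat.gcd m (4 * (q - 1) / h) = 2)
    (ϖ : ℂ) (hϖ : TwoZeroCode.IsFrobeniusPi p ϖ)
    (g β : K) (hg : g = TwoZeroCode.gElt F α h) (hβ : β = TwoZeroCode.betaElt α 4)
    (n : ℕ) (hn : n = TwoZeroCode.codeLength F K h)
    (A B T : ℂ)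
    (hA : A = TwoZeroCode.gaussPeriod p α 2 (1 : K))
    (hB : B = TwoZeroCode.gaussPeriod p α 2 (α : K))
    (hT : T = ϖ ^ (m * s) + (starRingEnd ℂ ϖ) ^ (m * s)) :
    -- `ϖ` and its conjugate are the Frobenius eigenvalues of `y² = x³ + 4x` over `GF(p)`
    (ϖ * starRingEnd ℂ ϖ = p ∧
      (Nat.card (TwoZeroCode.curveE p).Point : ℂ) = p + 1 - (ϖ + starRingEnd ℂ ϖ)) ∧
    -- the weight of each codeword in terms of the modified weight
    (∀ a b : K, (hammingNorm (TwoZeroCode.codeword F α h 4 a b) : ℂ) =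
      n - h * (r - 1) / (q * (q - 1)) - TwoZeroCode.modifiedWeight p F α h 4 2 a b) ∧
    -- `g (β + 1)` is a square
    (IsSquare (g * (β + 1)) →
      TwoZeroCode.IsDistribution (TwoZeroCode.genericPairs α 4)
        (TwoZeroCode.modifiedWeight p F α h 4 2) (TwoZeroCode.table1 q r h A B T) ∧
      TwoZeroCode.IsDistribution (TwoZeroCode.degeneratePairs α 4)
        (TwoZeroCode.modifiedWeight p F α h 4 2) (TwoZeroCode.table3 q r h A B) ∧
      ∀ w : ℕ, (TwoZeroCode.weightCount F α h 4 w : ℂ) =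
        (if w = 0 then 1 else 0) +
          TwoZeroCode.tableCount n q r h (TwoZeroCode.table1 q r h A B T) w +
          TwoZeroCode.tableCount n q r h (TwoZeroCode.table3 q r h A B) w) ∧
    -- `g (β + 1)` is not a square
    (¬ IsSquare (g * (β + 1)) →
      TwoZeroCode.IsDistribution (TwoZeroCode.genericPairs α 4)
        (TwoZeroCode.modifiedWeight p F α h 4 2) (TwoZeroCode.table2 q r h A B T) ∧
      TwoZeroCode.IsDistribution (TwoZeroCode.degeneratePairs α 4)
        (TwoZeroCode.modifiedWeight p F α h 4 2) (TwoZeroCode.table4 q r h A B) ∧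
      ∀ w : ℕ, (TwoZeroCode.weightCount F α h 4 w : ℂ) =
        (if w = 0 then 1 else 0) +
          TwoZeroCode.tableCount n q r h (TwoZeroCode.table2 q r h A B T) w +
          TwoZeroCode.tableCount n q r h (TwoZeroCode.table4 q r h A B) w) ∧
    -- eight weights, the weight `0` of the zero codeword included
    (¬ (q = 5 ∧ m = 2) →
      (hammingNorm '' TwoZeroCode.code F α h 4).ncard = 8 ∧
      {w ∈ hammingNorm '' TwoZeroCode.code F α h 4 | w ≠ 0}.ncard = 7) := by
  classical
  subst hF hm hg hβ hn
  obtain rfl : r = Fintype.card K := hr.trans Module.card_eq_pow_finrank.symm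
  have H : TwoZeroCode.Admissible F K h := ⟨h_four, h_dvd, h_gcd⟩
  have hK4 := H.card_mod_four
  have : CharP K p := charP_of_injective_algebraMap (algebraMap (ZMod p) K).injective p
  have hp2 : p ≠ 2 := by
    rintro rfl
    exact TwoZeroCode.ringChar_ne_two_of_card_mod_four hK4 (ringChar.eq K 2)
  have hcard : Fintype.card K = p ^ (Module.finrank F K * s) := by
    rw [hr, hq, ← pow_mul, mul_comm]
  have hS := (TwoZeroCode.sum_quadraticChar_eq_frobenius hcard hK4
    (fun _ => (even_iff_two_dvd.2 H.even_finrank).mul_right s) hϖ).1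
  rw [← hT] at hS
  have hA' : 2 * A = -1 + TwoZeroCode.quadraticGaussSum p K := by
    rw [hA, TwoZeroCode.gaussPeriod_one hα p]
  have hB' : 2 * B = -1 - TwoZeroCode.quadraticGaussSum p K := by
    rw [hB, H.gaussPeriod_generator hα p]
  have hg0 : TwoZeroCode.gElt F α h * (TwoZeroCode.betaElt α 4 + 1) ≠ 0 := by
    intro h0
    have h1 := H.quadraticChar_gElt_mul hα
    rw [h0, quadraticChar_zero] at h1
    exact TwoZeroCode.gElt_ne_zero (quadraticChar_eq_zero_iff.1 h1.symm)
  -- From here the case distinction reads `χ(g) = 1` or not.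
  rw [H.genericPairs_eq hα, H.degeneratePairs_eq hα, ← quadraticChar_one_iff_isSquare hg0,
    H.quadraticChar_gElt_mul hα]
  refine ⟨⟨TwoZeroCode.isFrobeniusPi_mul_conj hp2 hϖ,
    TwoZeroCode.card_curveE_point_eq_frobenius hp2 hϖ⟩, fun a b => H.hammingNorm_codeword hα a b,
    fun hχ => ?_, fun hχ => ?_, fun hne => ?_⟩
  · have h1 := TwoZeroCode.table1_fst (F := F) p hA' hB' h T
    have h3 := TwoZeroCode.table3_fst (F := F) p hA' hB' h
    rw [← hχ] at h3
    have hD := H.isDistribution_generic hα p T hS h1 fun j => by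
      rw [hχ]
      match j with
      | 0 => simp only [TwoZeroCode.table1, Matrix.cons_val]; push_cast; ring
      | 1 => simp only [TwoZeroCode.table1, Matrix.cons_val]; push_cast; ring
      | 2 => simp only [TwoZeroCode.table1, Matrix.cons_val]
      | 3 => simp only [TwoZeroCode.table1, Matrix.cons_val]
      | 4 => simp only [TwoZeroCode.table1, Matrix.cons_val]; push_cast; ring
    have hD' := H.isDistribution_degenerate hα p h3 fun j => match j with
      | 0 => rfl
      | 1 => rfl
    exact ⟨hD, hD', H.weightCount_eq hα p hD hD' h1 h3⟩
  · replace hχ := TwoZeroCode.quadraticChar_gElt.resolve_left hχ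
    have h1 := TwoZeroCode.table2_fst (F := F) p hA' hB' h T
    have h3 := TwoZeroCode.table4_fst (F := F) p hA' hB' h
    rw [← hχ] at h3
    have hD := H.isDistribution_generic hα p T hS h1 fun j => by
      rw [hχ]
      match j with
      | 0 => simp only [TwoZeroCode.table2, Matrix.cons_val]; push_cast; ring
      | 1 => simp only [TwoZeroCode.table2, Matrix.cons_val]; push_cast; ring
      | 2 => simp only [TwoZeroCode.table2, Matrix.cons_val]
      | 3 => simp only [TwoZeroCode.table2, Matrix.cons_val]
      | 4 => simp only [TwoZeroCode.table2, Matrix.cons_val]; push_cast; ring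
    have hD' := H.isDistribution_degenerate hα p h3 fun j => match j with
      | 0 => rfl
      | 1 => rfl
    exact ⟨hD, hD', H.weightCount_eq hα p hD hD' h1 h3⟩
  · have h8 := H.ncard_weights hα hne
    exact ⟨h8, TwoZeroCode.ncard_nonzero_weights h8⟩
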